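/- **Setting.** A power system consists of inflexible, flexible and stochastic generation with capacities $\overline p_I,\overline p_F,\overline p_W>0$. The marginal costs of the first two are $c_I,c_F>0$ and that of the third is $0$; $c_F^+$ and $c_F^-$ are the prices of upward and downward regulation of the flexible unit, $v$ is the cost of load curtailment, and $v>c_F^+\ge c_F\ge c_F^-\ge 0$. Assume $c_I<c_F$. The stochastic production $W$ is a random variable on a probability space with $0\le W\le\overline p_W$, whose cumulative distribution function $F$ is continuous on $(0,\infty)$ (an atom at $0$ is allowed). Put $F^{-1}(\alpha)=\inf\{x\ge 0: F(x)\ge\alpha\}$. The load $l\ge 0$ is known. *Stochastic dispatch solution.* A minimizer of $c_Ip_I+c_Fp_F+E[v\,s+c_F^+p_F^+-c_F^-p_F^-]$ over numbers $p_I\in[0,\overline p_I]$, $p_F\in[0,\overline p_F]$, $p_W$ with $p_F+p_I+p_W=l$ and measurable functions $p_F^+,p_F^-,\Delta p_W,s$ of $\omega$ with, for every $\omega$, $s+p_F^+-p_F^-+\Delta p_W=0$, $0\le p_F^-\le p_F$, $0\le p_F^+\le\overline p_F-p_F$, $0\le p_W+\Delta p_W\le W$, $0\le s\le l$. *Price-consistent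 merit-order dispatch solution (virtual bidding), or equilibrium.* Fix a cap $\widehat p_W\ge0$. An equilibrium is a tuple $(p_I,p_F,p_W,p_V,\lambda^f)$ with measurable functions $p_F^+,p_F^-,\Delta p_W,s$ of $\omega$, a function $\Delta p_V$ of $\omega$ and an integrable function $\lambda^b$ of $\omega$ that simultaneously satisfies: (a) the KKT conditions of minimizing $c_Fp_F+c_Ip_I$ subject to $p_F+p_I+p_W+p_V=l$ (multiplier $\lambda^f$), $0\le p_W\le\widehat p_W$, $0\le p_F\le\overline p_F$, $0\le p_I\le\overline p_I$; (b) for every $\omega$, the KKT conditions of minimizing $c_F^+p_F^+-c_F^-p_F^-+v s$ subject to $p_F^+-p_F^-+\Delta p_W+\Delta p_V+s=0$ (multiplier $\lambda^b(\omega)$), $0\le p_F^+\le\overline p_F-p_F$, $0\le p_F^-\le p_F$, $0\le p_W+\Delta p_W\le W(\omega)$, $0\le s\le l$; (c) $(p_V,\Delta p_V)$ maximizes $p_V\lambda^f+E[\Delta p_V\lambda^b]$ subject to $p_V+\Delta p_V(\omega)=0$ for all $\omega$. Its expected system operating cost is $c_Ip_I+c_Fp_F+E[v\,s+c_F^+p_F^+-c_F^-p_F^-]$.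 It is *cost-efficient* if this equals the cost of the stochastic dispatch solutions. *Constants.* Let $G^{\pm}(y)=(v-c_F^{\pm})F(y-\overline p_F)+c_F^{\pm}F(y)$ and $$l_1=F^{-1}\Big(\tfrac{c_F-c_F^-}{c_F^+-c_F^-}\Big),\quad l_2=\min\{l\ge0:G^+(l)\ge c_I\},$$ $$l_3=\min\{l\ge l_1: c_F+(v-c_F^+)F(l-\overline p_F)-c_F^-(1-F(l))\ge c_I\},\quad l_4=\min\{l\ge l_1+\overline p_F: G^-(l)\ge c_I\},$$ $$l_5=\min\{l\ge0: G^+(l-\overline p_I)\ge c_F\},\qquad l_6=\min\{l\ge0: G^-(l-\overline p_I)\ge c_F\}.$$ In $l_1$ the quotient $0/0$ is set to $0$ (so that $l_1=0$ if $c_F^+=c_F=c_F^-$). **Corollary (Merit-order dispatch solution with virtual bidding).** For every $l\ge0$ there are a stochastic dispatch solution and an equilibrium; if $l\le l_5$ there is an equilibrium with $p_F=0$, and if $l\ge l_6$ there is one with $p_F=\overline p_F$. Every equilibrium at load $l$ is cost-efficient in each of the following cases (where, in cases 1 and 3, for the boundary load $l=l_5$ only equilibria with $p_F=0$ are considered):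 1. $l_1\ge l_2$, $l_1>0$ and $0\le l\le\min(\overline p_I+l_1,\,l_5)$ (if $F(0)=0$, then $l_1>0$ follows from $l_1\ge l_2$); 2. $c_F^+>c_F^-$, $\frac{c_F-c_F^-}{c_F^+-c_F^-}\ge\frac{c_I}{c_F^+}$, $\overline p_F>\overline p_W$ and $0\le l\le\overline p_I+l_1$; 3. $c_F^+=c_F$ and $l\notin(l_5,\ \overline p_W+\overline p_I+\overline p_F)$; 4. $c_F^+=c_F$, $\overline p_F>\overline p_W$, and $0\le l\le\overline p_I+\overline p_W$ or $l\ge\overline p_W+\overline p_I+\overline p_F$; 5. $c_F=c_F^+=c_F^-$. Furthermore, suppose that $c_F=c_F^-$, $c_F^+>c_F$, and that $0$ is the only $x\ge0$ with $F(x)=0$ (that is, $F^{-1}(0)=0$). Let $T=\max(l_6,\,l_4+\overline p_I)$ if $l_3>\overline p_F$, and $T=\max(l_6,\,\overline p_F+\overline p_I)$ otherwise. * If $l\ge T$, every equilibrium at load $l$ is cost-efficient (where, if $G^-(l-\overline p_I)=c_F$, only equilibria with $p_F=\overline p_F$ are considered). * If $F(y)<1$ for all $y<\overline p_F$, then for $0<l<T$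 no equilibrium is cost-efficient: its expected cost is strictly larger than that of the stochastic dispatch solution. * If $F(y)=1$ for some $y<\overline p_F$, then for $0<l<l_6$ no equilibrium is cost-efficient, and for $l\ge l_6$ every equilibrium is. -/

import Mathlib

open MeasureTheory ProbabilityTheory

noncomputable section

/-- The stylized power system: capacities `capI, capF, capW`, marginal costs `cI, cF`,
upward / downward regulation prices `cUp, cDown`, cost `v` of load curtailment, and the random
stochastic power production `W` on the probability space `(Ω, P)`. -/
structure PowerSystem (Ω : Type*) [MeasurableSpace Ω] where
  P : Measure Ω
  isProb : IsProbabilityMeasure P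
  W : Ω → ℝ
  measurable_W : Measurable W
  capI : ℝ
  capF : ℝ
  capW : ℝ
  cI : ℝ
  cF : ℝ
  cUp : ℝ
  cDown : ℝ
  v : ℝ
  capI_pos : 0 < capI
  capF_pos : 0 < capF
  capW_pos : 0 < capW
  cI_pos : 0 < cI
  cF_pos : 0 < cF
  cUp_lt_v : cUp < v
  cF_le_cUp : cF ≤ cUp
  cDown_le_cF : cDown ≤ cF
  cDown_nonneg : 0 ≤ cDown
  W_nonneg : ∀ ω, 0 ≤ W ω
  W_le : ∀ ω, W ω ≤ capW

/-- Redispatch decisions of the balancing stage, scenario by scenario: upward regulation `up`,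
downward regulation `down`, change `dW` of the stochastic production, load shedding `shed`. -/
structure Redispatch (Ω : Type*) where
  up : Ω → ℝ
  down : Ω → ℝ
  dW : Ω → ℝ
  shed : Ω → ℝ

/-- A forward dispatch together with a redispatch rule. -/
structure StochasticSchedule (Ω : Type*) where
  pI : ℝ
  pF : ℝ
  pW : ℝ
  r : Redispatch Ω

/-- A tuple of forward dispatch, virtual bid `pV`, redispatch, settlement `dV` of the virtual bid
in the balancing market, forward price `lamF` and balancing price `lamB`. -/
structure VirtualBiddingOutcome (Ω : Type*) where
  pI : ℝ
  pF : ℝ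
  pW : ℝ
  pV : ℝ
  dV : Ω → ℝ
  r : Redispatch Ω
  lamF : ℝ
  lamB : Ω → ℝ

/-- The part of the Karush-Kuhn-Tucker conditions of a linear program that concerns one variable
with bounds `a ≤ x ≤ b`: feasibility, nonnegative multipliers `lo`, `hi` of the two bounds with
complementary slackness, and stationarity, where `g` is the partial derivative of
cost minus (price times balance). -/
def BoxKKT (g x a b : ℝ) : Prop :=
  a ≤ x ∧ x ≤ b ∧ ∃ lo hi : ℝ, 0 ≤ lo ∧ 0 ≤ hi ∧
    lo * (x - a) = 0 ∧ hi * (b - x) = 0 ∧ g - lo + hi = 0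

namespace PowerSystem

variable {Ω : Type*} [MeasurableSpace Ω] (M : PowerSystem Ω)

/-- The cumulative distribution function of `W`. -/
def F (x : ℝ) : ℝ := cdf (M.P.map M.W) x

/-- The generalized inverse of `F`. As `W ≥ 0`, restricting to `x ≥ 0` changes nothing for
`0 < α ≤ 1`; at `α = 0` it gives the value `0`. -/
def Finv (α : ℝ) : ℝ := sInf {x : ℝ | 0 ≤ x ∧ α ≤ M.F x}

/-- `(v - c⁺) F(y - capF) + c⁺ F(y)`. -/
def priceUp (y : ℝ) : ℝ := (M.v - M.cUp) * M.F (y - M.capF) + M.cUp * M.F y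

/-- `(v - c⁻) F(y - capF) + c⁻ F(y)`. -/
def priceDown (y : ℝ) : ℝ := (M.v - M.cDown) * M.F (y - M.capF) + M.cDown * M.F y

/-! The characteristic constants. If `cI < cF`, the sets in the minimization problems are nonempty
and bounded below, so that the infima are genuine (and attained). -/

def l1 : ℝ := M.Finv ((M.cF - M.cDown) / (M.cUp - M.cDown))

def l2 : ℝ := sInf {l : ℝ | 0 ≤ l ∧ M.cI ≤ M.priceUp l}

def l3 : ℝ := sInf {l : ℝ | M.l1 ≤ l ∧
  M.cI ≤ M.cF + (M.v - M.cUp) * M.F (l - M.capF) - M.cDown * (1 - M.F l)}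

def l4 : ℝ := sInf {l : ℝ | M.l1 + M.capF ≤ l ∧ M.cI ≤ M.priceDown l}

def l5 : ℝ := sInf {l : ℝ | 0 ≤ l ∧ M.cF ≤ M.priceUp (l - M.capI)}

def l6 : ℝ := sInf {l : ℝ | 0 ≤ l ∧ M.cF ≤ M.priceDown (l - M.capI)}

/-- Total expected operating cost of forward quantities `pI`, `pF` and a redispatch rule. -/
def expectedCost (pI pF : ℝ) (r : Redispatch Ω) : ℝ :=
  M.cI * pI + M.cF * pF +
    ∫ ω, (M.v * r.shed ω + M.cUp * r.up ω - M.cDown * r.down ω) ∂M.P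

/-! ### The stochastic two-stage market -/

/-- The constraints of the stochastic market-clearing problem at load `l`. -/
structure IsFeasible (l : ℝ) (S : StochasticSchedule Ω) : Prop where
  measurable_up : Measurable S.r.up
  measurable_down : Measurable S.r.down
  measurable_dW : Measurable S.r.dW
  measurable_shed : Measurable S.r.shed
  forward_balance : S.pF + S.pI + S.pW = l
  pF_mem : S.pF ∈ Set.Icc 0 M.capF
  pI_mem : S.pI ∈ Set.Icc 0 M.capI
  balance : ∀ ω, S.r.shed ω + S.r.up ω - S.r.down ω + S.r.dW ω = 0
  down_mem : ∀ ω, S.r.down ω ∈ Set.Icc 0 S.pF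
  up_mem : ∀ ω, S.r.up ω ∈ Set.Icc 0 (M.capF - S.pF)
  wind_mem : ∀ ω, S.pW + S.r.dW ω ∈ Set.Icc 0 (M.W ω)
  shed_mem : ∀ ω, S.r.shed ω ∈ Set.Icc 0 l

/-- `S` is a stochastic dispatch solution at load `l`: it minimizes the total expected cost. -/
def IsStochasticSolution (l : ℝ) (S : StochasticSchedule Ω) : Prop :=
  M.IsFeasible l S ∧ ∀ S' : StochasticSchedule Ω, M.IsFeasible l S' →
    M.expectedCost S.pI S.pF S.r ≤ M.expectedCost S'.pI S'.pF S'.r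

/-! ### The conventional two-stage market with virtual bidding -/

/-- `E` is a price-consistent merit-order solution at load `l`, i.e. a short-run equilibrium: the
optimality conditions of the forward market clearing (where the forward dispatch of stochastic
production is capped by `pWhat`), of the balancing market clearing in each scenario, and of the
arbitrager's profit maximization hold simultaneously. -/
structure IsEquilibrium (pWhat l : ℝ) (E : VirtualBiddingOutcome Ω) : Prop where
  measurable_up : Measurable E.r.up
  measurable_down : Measurable E.r.down
  measurable_dW : Measurable E.r.dW
  measurable_shed : Measurable E.r.shed
  integrable_lamB : Integrable E.lamB M.P
  /- forward market -/
  forward_balance : E.pF + E.pI + E.pW + E.pV = l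
  forward_pW : BoxKKT (0 - E.lamF) E.pW 0 pWhat
  forward_pF : BoxKKT (M.cF - E.lamF) E.pF 0 M.capF
  forward_pI : BoxKKT (M.cI - E.lamF) E.pI 0 M.capI
  /- balancing market -/
  balance : ∀ ω, E.r.up ω - E.r.down ω + E.r.dW ω + E.dV ω + E.r.shed ω = 0
  bal_up : ∀ ω, BoxKKT (M.cUp - E.lamB ω) (E.r.up ω) 0 (M.capF - E.pF)
  bal_down : ∀ ω, BoxKKT (-M.cDown + E.lamB ω) (E.r.down ω) 0 E.pF
  bal_wind : ∀ ω, BoxKKT (0 - E.lamB ω) (E.pW + E.r.dW ω) 0 (M.W ω)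
  bal_shed : ∀ ω, BoxKKT (M.v - E.lamB ω) (E.r.shed ω) 0 l
  /- arbitrager -/
  arb_feasible : ∀ ω, E.pV + E.dV ω = 0
  arb_optimal : ∀ (q : ℝ) (d : Ω → ℝ), (∀ ω, q + d ω = 0) →
    q * E.lamF + ∫ ω, d ω * E.lamB ω ∂M.P ≤
      E.pV * E.lamF + ∫ ω, E.dV ω * E.lamB ω ∂M.P

/-- The load from which on virtual bidding closes the gap under free downward regulation. -/
def threshold : ℝ :=
  open Classical in
  if M.capF < M.l3 then max M.l6 (M.l4 + M.capI) else max M.l6 (M.capF + M.capI)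

end PowerSystem

end

/-!
A forward dispatch matters only through the demand `y = l - pI` that the inflexible unit leaves and
the flexible forward quantity `q = pF`. With `H t = E (t - W)⁺`, a convex function with
derivative `F`, the expected cost under optimal redispatch is the convex function
`cI (l - y) + (v - c⁺) H (y - capF) + c⁻ H y + (cF - c⁻) q + (c⁺ - c⁻) H (y - q)`
(`reducedCost`). Stochastic dispatch solutions minimize it over a compact rectangle.

In an equilibrium the arbitrager forces `λᶠ = E λᵇ`, and adding up the variational inequalities of
the two markets shows that `y` minimizes the reduced cost for the equilibrium's own `q`
(`IsEquilibrium.expectedCost_le`). What remains is the choice of `q`. The true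
optimality condition in `q` is of newsvendor type, `(c⁺ - c⁻) F (y - q) = cF - c⁻`, whereas the
forward market compares `cF` with `λᶠ`, which lies between `priceLeft y q` and `priceRight y q`,
the expectations of the extreme balancing prices. In particular `q > 0` requires `λᶠ ≥ cF > cI` and
therefore `pI = capI`. In each case this restricts `q` enough for the subgradient inequality of the
reduced cost (`reducedCost_add_le`) to prove optimality. Under free downward regulation, full
flexible scheduling is optimal for every `y`. At positive loads below `l6` every equilibrium bears
strictly more expected upward regulation than that; from `l6` on the forward price supports
`q = capF`.

Equilibria are constructed from the demand `l`, `l2` or `l - capI`, depending on whether the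
inflexible unit is idle, marginal or exhausted, with balancing prices that are convex combinations
of the two extreme ones.
-/

open Set Filter Topology

/-! ### Complementary slackness for a box constraint -/

namespace BoxKKT

theorem iff_sign {g x a b : ℝ} :
    BoxKKT g x a b ↔ a ≤ x ∧ x ≤ b ∧ (0 < g → x = a) ∧ (g < 0 → x = b) := by
  constructor
  · rintro ⟨ha, hb, lo, hi, hlo, hhi, h1, h2, h3⟩
    refine ⟨ha, hb, fun hg => ?_, fun hg => ?_⟩
    · rcases mul_eq_zero.1 h1 with h | h <;> linarith
    · rcases mul_eq_zero.1 h2 with h | h <;> linarith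
  · rintro ⟨ha, hb, h1, h2⟩
    rcases lt_trichotomy g 0 with hg | hg | hg
    · exact ⟨ha, hb, 0, -g, le_rfl, by linarith, by simp, by simp [h2 hg], by ring⟩
    · exact ⟨ha, hb, 0, 0, le_rfl, le_rfl, by simp, by simp, by simp [hg]⟩
    · exact ⟨ha, hb, g, 0, hg.le, le_rfl, by simp [h1 hg], by simp, by ring⟩

/-- The variational inequality: no feasible move decreases the linear objective. -/
theorem mul_sub_nonneg {g x a b x' : ℝ} (h : BoxKKT g x a b) (hx' : x' ∈ Icc a b) :
    0 ≤ g * (x' - x) := by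
  obtain ⟨-, -, h1, h2⟩ := iff_sign.1 h
  rcases lt_trichotomy g 0 with hg | hg | hg
  · exact mul_nonneg_of_nonpos_of_nonpos hg.le (by rw [h2 hg]; linarith [hx'.2])
  · simp [hg]
  · exact mul_nonneg hg.le (by rw [h1 hg]; linarith [hx'.1])

end BoxKKT

/-! ### Monotone functions and infima of superlevel sets -/

/-- A right-continuous monotone function attains the bound at the infimum of a superlevel set. -/
theorem le_apply_csInf_of_rightContinuous {G : ℝ → ℝ} (hG : Monotone G)
    (hr : ∀ x, ContinuousWithinAt G (Ioi x) x) {S : Set ℝ} {c : ℝ} (hS : S.Nonempty)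
    (hc : ∀ x ∈ S, c ≤ G x) : c ≤ G (sInf S) := by
  refine ge_of_tendsto (hr (sInf S)) ?_
  filter_upwards [self_mem_nhdsWithin] with x hx
  obtain ⟨z, hz, hzx⟩ := exists_lt_of_csInf_lt hS hx
  exact (hc z hz).trans (hG hzx.le)

theorem tendsto_sub_nhdsLT (t k : ℝ) : Tendsto (fun x => x - k) (𝓝[<] t) (𝓝[<] (t - k)) := by
  refine tendsto_nhdsWithin_iff.2 ⟨?_, ?_⟩
  · exact ((continuous_id.sub continuous_const).tendsto t).mono_left nhdsWithin_le_nhds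
  · filter_upwards [self_mem_nhdsWithin] with x hx
    exact sub_lt_sub_right hx k

theorem tendsto_sub_nhdsGT (t k : ℝ) : Tendsto (fun x => x - k) (𝓝[>] t) (𝓝[>] (t - k)) := by
  refine tendsto_nhdsWithin_iff.2 ⟨?_, ?_⟩
  · exact ((continuous_id.sub continuous_const).tendsto t).mono_left nhdsWithin_le_nhds
  · filter_upwards [self_mem_nhdsWithin] with x hx
    exact sub_lt_sub_right hx k

namespace PowerSystem

variable {Ω : Type*} [MeasurableSpace Ω] (M : PowerSystem Ω)

instance isProbabilityMeasure_P : IsProbabilityMeasure M.P := M.isProb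

/-! ### The distribution function of the stochastic production -/

theorem isProbabilityMeasure_map : IsProbabilityMeasure (M.P.map M.W) :=
  Measure.isProbabilityMeasure_map M.measurable_W.aemeasurable

theorem measurableSet_W_le (t : ℝ) : MeasurableSet {ω | M.W ω ≤ t} :=
  measurableSet_le M.measurable_W measurable_const

theorem measurableSet_W_lt (t : ℝ) : MeasurableSet {ω | M.W ω < t} :=
  measurableSet_lt M.measurable_W measurable_const

theorem F_eq_real (t : ℝ) : M.F t = M.P.real {ω | M.W ω ≤ t} := by
  have := M.isProbabilityMeasure_map
  rw [F, cdf_eq_real, map_measureReal_apply M.measurable_W measurableSet_Iic]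
  rfl

/-- `P(W < t)`, the left limit of the distribution function at `t`. -/
noncomputable def Fleft (t : ℝ) : ℝ := M.P.real {ω | M.W ω < t}

theorem F_mono : Monotone M.F := monotone_cdf _

theorem F_nonneg (t : ℝ) : 0 ≤ M.F t := cdf_nonneg _ t

theorem F_le_one (t : ℝ) : M.F t ≤ 1 := cdf_le_one _ t

theorem F_of_neg {t : ℝ} (ht : t < 0) : M.F t = 0 := by
  have : {ω | M.W ω ≤ t} = ∅ := by
    ext ω
    simpa using ht.trans_le (M.W_nonneg ω)
  rw [F_eq_real, this]
  simp

theorem F_of_capW_le {t : ℝ} (ht : M.capW ≤ t) : M.F t = 1 := by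
  have : {ω | M.W ω ≤ t} = univ := by
    ext ω
    simpa using (M.W_le ω).trans ht
  rw [F_eq_real, this]
  simp

theorem F_rightContinuous (t : ℝ) : ContinuousWithinAt M.F (Ioi t) t :=
  ((cdf (M.P.map M.W)).right_continuous t).mono Ioi_subset_Ici_self

theorem Fleft_eq_leftLim (t : ℝ) : M.Fleft t = Function.leftLim M.F t := by
  have := M.isProbabilityMeasure_map
  have h0 : 0 ≤ Function.leftLim M.F t :=
    (M.F_nonneg (t - 1)).trans (M.F_mono.le_leftLim (by linarith))
  have h := (cdf (M.P.map M.W)).measure_Iio (tendsto_cdf_atBot _) t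
  rw [measure_cdf, Measure.map_apply M.measurable_W measurableSet_Iio, sub_zero] at h
  have h2 : M.Fleft t = (M.P (M.W ⁻¹' Iio t)).toReal := rfl
  rw [h2, h]
  exact ENNReal.toReal_ofReal h0

theorem tendsto_Fleft (t : ℝ) : Tendsto M.F (𝓝[<] t) (𝓝 (M.Fleft t)) := by
  rw [Fleft_eq_leftLim]
  exact M.F_mono.tendsto_leftLim t

theorem Fleft_le_F (t : ℝ) : M.Fleft t ≤ M.F t := by
  rw [Fleft_eq_leftLim]
  exact M.F_mono.leftLim_le le_rfl

theorem Fleft_eq_F {t : ℝ} (h : ContinuousAt M.F t) : M.Fleft t = M.F t :=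
  tendsto_nhds_unique (M.tendsto_Fleft t) (h.tendsto.mono_left nhdsWithin_le_nhds)

/-! ### The expected residual demand -/

/-- The residual demand `(t - W)⁺` left by the stochastic production. -/
def residual (t : ℝ) (ω : Ω) : ℝ := max (t - M.W ω) 0

/-- The expected residual demand `E (t - W)⁺`, the convex primitive of `F` that vanishes on
`(-∞, 0]`. -/
noncomputable def H (t : ℝ) : ℝ := ∫ ω, M.residual t ω ∂M.P

theorem residual_nonneg (t : ℝ) (ω : Ω) : 0 ≤ M.residual t ω := le_max_right _ _

theorem sub_le_residual (t : ℝ) (ω : Ω) : t - M.W ω ≤ M.residual t ω := le_max_left _ _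

theorem residual_mono (ω : Ω) : Monotone fun t => M.residual t ω :=
  fun _ _ h => max_le_max_right _ (by linarith)

theorem residual_le_add {s t : ℝ} (h : s ≤ t) (ω : Ω) :
    M.residual t ω ≤ M.residual s ω + (t - s) :=
  max_le (by linarith [M.sub_le_residual s ω]) (by linarith [M.residual_nonneg s ω])

theorem residual_le {t : ℝ} (ht : 0 ≤ t) (ω : Ω) : M.residual t ω ≤ t :=
  max_le (by linarith [M.W_nonneg ω]) ht

theorem measurable_residual (t : ℝ) : Measurable (M.residual t) :=
  (measurable_const.sub M.measurable_W).max measurable_const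

theorem integrable_of_mem_Icc {f : Ω → ℝ} (hf : Measurable f) {a b : ℝ}
    (h : ∀ ω, f ω ∈ Icc a b) : Integrable f M.P :=
  Integrable.of_mem_Icc a b hf.aemeasurable (ae_of_all _ h)

theorem integrable_residual (t : ℝ) : Integrable (M.residual t) M.P :=
  M.integrable_of_mem_Icc (M.measurable_residual t) (a := 0) (b := max t 0) fun ω =>
    ⟨M.residual_nonneg t ω, max_le_max_right _ (by linarith [M.W_nonneg ω])⟩

theorem H_of_nonpos {t : ℝ} (ht : t ≤ 0) : M.H t = 0 := by
  have : M.residual t = fun _ => 0 := by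
    funext ω
    exact max_eq_right (by linarith [M.W_nonneg ω])
  simp [H, this]

theorem H_mono : Monotone M.H := fun s t h =>
  integral_mono (M.integrable_residual s) (M.integrable_residual t)
    fun ω => M.residual_mono ω h

theorem continuous_H : Continuous M.H := by
  refine (LipschitzWith.of_le_add fun s t => ?_).continuous
  rcases le_total s t with h | h
  · exact (M.H_mono h).trans (by simp)
  · have h1 : M.H s ≤ ∫ ω, (M.residual t ω + (s - t)) ∂M.P :=
      integral_mono (M.integrable_residual s) ((M.integrable_residual t).add (integrable_const _))
        fun ω => M.residual_le_add h ω
    rw [integral_add (M.integrable_residual t) (integrable_const _)] at h1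
    rw [Real.dist_eq, abs_of_nonneg (by linarith)]
    simpa [H] using h1

theorem integrable_indicator_one {A : Set Ω} (hA : MeasurableSet A) :
    Integrable (A.indicator (fun _ => (1 : ℝ))) M.P :=
  (integrable_const 1).indicator hA

/-- `F t` is a subgradient of `H` at `t`. -/
theorem H_add_F_mul_le (t t' : ℝ) : M.H t + M.F t * (t' - t) ≤ M.H t' := by
  have hi := (M.integrable_indicator_one (M.measurableSet_W_le t)).mul_const (t' - t)
  have h1 : ∫ ω, (M.residual t ω + {ω | M.W ω ≤ t}.indicator (fun _ => (1 : ℝ)) ω * (t' - t)) ∂M.P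
      ≤ M.H t' := by
    refine integral_mono ((M.integrable_residual t).add hi) (M.integrable_residual t') fun ω => ?_
    by_cases h : M.W ω ≤ t
    · have h2 : M.residual t ω = t - M.W ω := max_eq_left (by linarith)
      simp only [mem_ofPred_eq, h, indicator_of_mem, h2, one_mul]
      linarith [M.sub_le_residual t' ω]
    · have h2 : M.residual t ω = 0 := max_eq_right (by linarith [not_le.1 h])
      simp only [mem_ofPred_eq, h, not_false_eq_true, indicator_of_notMem, h2]
      linarith [M.residual_nonneg t' ω]
  rw [integral_add (M.integrable_residual t) hi, integral_mul_const,
    integral_indicator_const _ (M.measurableSet_W_le t)] at h1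
  rw [F_eq_real]
  simpa [H] using h1

theorem H_lt {s t : ℝ} (hpos : ∀ x, 0 < x → 0 < M.F x) (hst : s < t) (ht : 0 < t) :
    M.H s < M.H t := by
  have h1 : max s (t / 2) < t := max_lt hst (by linarith)
  have h2 : 0 < M.F (max s (t / 2)) := hpos _ (lt_max_of_lt_right (by linarith))
  have h3 := M.H_add_F_mul_le (max s (t / 2)) t
  have h4 := M.H_mono (le_max_left s (t / 2))
  nlinarith [mul_pos h2 (sub_pos.2 h1)]

/-! ### The generalized inverse -/

theorem le_F_Finv {α : ℝ} (hα : α ≤ 1) : α ≤ M.F (M.Finv α) :=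
  le_apply_csInf_of_rightContinuous M.F_mono M.F_rightContinuous
    (S := {x : ℝ | 0 ≤ x ∧ α ≤ M.F x})
    ⟨M.capW, M.capW_pos.le, by rwa [M.F_of_capW_le le_rfl]⟩ fun _ hx => hx.2

theorem Finv_nonneg (α : ℝ) : 0 ≤ M.Finv α := Real.sInf_nonneg fun _ hx => And.left hx

theorem Finv_le_capW {α : ℝ} (hα : α ≤ 1) : M.Finv α ≤ M.capW :=
  csInf_le (s := {x : ℝ | 0 ≤ x ∧ α ≤ M.F x}) ⟨0, fun _ hx => hx.1⟩
    ⟨M.capW_pos.le, by rwa [M.F_of_capW_le le_rfl]⟩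

theorem F_lt_of_lt_Finv {α t : ℝ} (hα : 0 < α) (ht : t < M.Finv α) : M.F t < α := by
  by_contra! h
  rcases lt_or_ge t 0 with h0 | h0
  · rw [M.F_of_neg h0] at h
    linarith
  · exact notMem_of_lt_csInf ht ⟨0, fun _ hx => And.left hx⟩ ⟨h0, h⟩

/-- `α` is a subgradient of `H` at the quantile `F⁻¹(α)`, whether or not `F` takes the
value `α` there. -/
theorem H_Finv_add_mul_le {α : ℝ} (hα0 : 0 < α) (hα1 : α ≤ 1) (t : ℝ) :
    M.H (M.Finv α) + α * (t - M.Finv α) ≤ M.H t := by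
  rcases le_or_gt (M.Finv α) t with h | h
  · have h1 := M.H_add_F_mul_le (M.Finv α) t
    nlinarith [mul_nonneg (sub_nonneg.2 (M.le_F_Finv hα1)) (sub_nonneg.2 h)]
  · have hc : Continuous fun r => M.H r + α * (t - r) := by
      have := M.continuous_H
      fun_prop
    refine le_of_tendsto ((hc.tendsto (M.Finv α)).mono_left nhdsWithin_le_nhds)
      (f := fun r => M.H r + α * (t - r)) (x := 𝓝[<] (M.Finv α)) ?_
    filter_upwards [Ioo_mem_nhdsLT h] with r hr
    have h1 := M.H_add_F_mul_le r t
    have h2 := M.F_lt_of_lt_Finv hα0 hr.2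
    nlinarith [mul_nonneg (sub_nonneg.2 h2.le) (sub_nonneg.2 hr.1.le)]

theorem F_Finv {α : ℝ} (hα0 : 0 < α) (hα1 : α ≤ 1) (h : ContinuousAt M.F (M.Finv α)) :
    M.F (M.Finv α) = α := by
  refine le_antisymm ?_ (M.le_F_Finv hα1)
  refine le_of_tendsto (h.tendsto.mono_left nhdsWithin_le_nhds) (x := 𝓝[<] (M.Finv α)) ?_
  filter_upwards [self_mem_nhdsWithin] with r hr
  exact (M.F_lt_of_lt_Finv hα0 hr).le

/-! ### Optimal redispatch and the reduced problem -/

/-- The expected operating cost at load `l` if the inflexible unit leaves the demand `y = l - pI`,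
the flexible unit is scheduled at `q = pF`, and redispatch is optimal. -/
noncomputable def reducedCost (l y q : ℝ) : ℝ :=
  M.cI * (l - y) + (M.v - M.cUp) * M.H (y - M.capF) + M.cDown * M.H y +
    (M.cF - M.cDown) * q + (M.cUp - M.cDown) * M.H (y - q)

/-- The pairs `(y, q) = (l - pI, pF)` that forward dispatches at load `l` can realize. -/
def dispatchSet (l : ℝ) : Set (ℝ × ℝ) := Icc (max 0 (l - M.capI)) l ×ˢ Icc 0 M.capF

variable {M} in
theorem mem_dispatchSet {l y q : ℝ} :
    (y, q) ∈ M.dispatchSet l ↔ (0 ≤ y ∧ l - M.capI ≤ y ∧ y ≤ l) ∧ 0 ≤ q ∧ q ≤ M.capF := by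
  simp only [dispatchSet, mem_prod, mem_Icc, max_le_iff, and_assoc]

theorem cUp_pos : 0 < M.cUp := M.cF_pos.trans_le M.cF_le_cUp

theorem cDown_le_cUp : M.cDown ≤ M.cUp := M.cDown_le_cF.trans M.cF_le_cUp

/-- The redispatch cost in terms of residual demands. -/
theorem integral_residual_combination (y q : ℝ) :
    ∫ ω, ((M.v - M.cUp) * M.residual (y - M.capF) ω + M.cDown * M.residual y ω - M.cDown * q +
      (M.cUp - M.cDown) * M.residual (y - q) ω) ∂M.P =
    (M.v - M.cUp) * M.H (y - M.capF) + M.cDown * M.H y - M.cDown * q +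
      (M.cUp - M.cDown) * M.H (y - q) := by
  have h1 := (M.integrable_residual (y - M.capF)).const_mul (M.v - M.cUp)
  have h2 := (M.integrable_residual y).const_mul M.cDown
  have h3 := (M.integrable_residual (y - q)).const_mul (M.cUp - M.cDown)
  have h12 : Integrable (fun ω => (M.v - M.cUp) * M.residual (y - M.capF) ω +
      M.cDown * M.residual y ω) M.P := h1.add h2
  have h12' : Integrable (fun ω => (M.v - M.cUp) * M.residual (y - M.capF) ω +
      M.cDown * M.residual y ω - M.cDown * q) M.P := h12.sub (integrable_const _)
  rw [integral_add h12' h3, integral_sub h12 (integrable_const _), integral_add h1 h2]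
  simp [integral_const_mul, H]

variable {M} in
theorem IsFeasible.integrable_cost {l : ℝ} {S : StochasticSchedule Ω} (hS : M.IsFeasible l S) :
    Integrable (fun ω => M.v * S.r.shed ω + M.cUp * S.r.up ω - M.cDown * S.r.down ω) M.P :=
  (((M.integrable_of_mem_Icc hS.measurable_shed hS.shed_mem).const_mul _).add
    ((M.integrable_of_mem_Icc hS.measurable_up hS.up_mem).const_mul _)).sub
    ((M.integrable_of_mem_Icc hS.measurable_down hS.down_mem).const_mul _)

variable {M} in
theorem IsFeasible.balance_eq {l : ℝ} {S : StochasticSchedule Ω} (hS : M.IsFeasible l S) (ω : Ω) :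
    S.pF + S.r.up ω - S.r.down ω + (S.pW + S.r.dW ω) + S.r.shed ω = l - S.pI := by
  linarith [hS.balance ω, hS.forward_balance]

variable {M} in
theorem IsFeasible.mem_dispatchSet {l : ℝ} {S : StochasticSchedule Ω} (hS : M.IsFeasible l S) :
    (l - S.pI, S.pF) ∈ M.dispatchSet l := by
  obtain ⟨ω⟩ := nonempty_of_isProbabilityMeasure M.P
  refine PowerSystem.mem_dispatchSet.2 ⟨⟨?_, ?_, ?_⟩, hS.pF_mem⟩
  · linarith [hS.balance_eq ω, (hS.down_mem ω).2, (hS.up_mem ω).1, (hS.wind_mem ω).1,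
      (hS.shed_mem ω).1]
  · linarith [hS.pI_mem.2]
  · linarith [hS.pI_mem.1]

variable {M} in
theorem IsFeasible.reducedCost_le {l : ℝ} {S : StochasticSchedule Ω} (hS : M.IsFeasible l S) :
    M.reducedCost l (l - S.pI) S.pF ≤ M.expectedCost S.pI S.pF S.r := by
  have h := integral_mono (((((M.integrable_residual (l - S.pI - M.capF)).const_mul
    (M.v - M.cUp)).add ((M.integrable_residual (l - S.pI)).const_mul M.cDown)).sub
    (integrable_const (M.cDown * S.pF))).add
    ((M.integrable_residual (l - S.pI - S.pF)).const_mul (M.cUp - M.cDown))) hS.integrable_cost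
    fun ω => ?_
  · have h2 := M.integral_residual_combination (l - S.pI) S.pF
    simp only [Pi.add_apply, Pi.sub_apply] at h
    rw [reducedCost, expectedCost]
    linarith
  · obtain ⟨hd0, hd1⟩ := hS.down_mem ω
    obtain ⟨hu0, hu1⟩ := hS.up_mem ω
    obtain ⟨hw0, hw1⟩ := hS.wind_mem ω
    obtain ⟨hs0, hs1⟩ := hS.shed_mem ω
    have hb := hS.balance_eq ω
    have h1 : M.residual (l - S.pI - M.capF) ω ≤ S.r.shed ω := max_le (by linarith) hs0
    have h2 : M.residual (l - S.pI - S.pF) ω ≤ S.r.up ω + S.r.shed ω :=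
      max_le (by linarith) (by linarith)
    have h3 : M.residual (l - S.pI) ω ≤ S.pF + S.r.up ω - S.r.down ω + S.r.shed ω :=
      max_le (by linarith) (by linarith)
    have h1' := mul_le_mul_of_nonneg_left h1 (sub_nonneg.2 M.cUp_lt_v.le)
    have h2' := mul_le_mul_of_nonneg_left h2 (sub_nonneg.2 M.cDown_le_cUp)
    have h3' := mul_le_mul_of_nonneg_left h3 M.cDown_nonneg
    simp only [Pi.add_apply, Pi.sub_apply]
    linarith

/-- The merit-order redispatch that meets the demand `y` when the flexible unit is scheduled at `q`
and the stochastic unit at `pW`: stochastic production first, then flexible production up to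
its capacity, then load shedding. -/
def meritOrder (pW y q : ℝ) : Redispatch Ω where
  up ω := M.residual (y - q) ω - M.residual (y - M.capF) ω
  down ω := q + M.residual (y - q) ω - M.residual y ω
  dW ω := y - M.residual y ω - pW
  shed ω := M.residual (y - M.capF) ω

/-- The schedule with demand `y = l - pI`, flexible forward quantity `q` and merit-order
redispatch. -/
def meritOrderSchedule (l y q : ℝ) : StochasticSchedule Ω where
  pI := l - y
  pF := q
  pW := y - q
  r := M.meritOrder (y - q) y q

theorem meritOrder_bounds {l y q : ℝ} (h : (y, q) ∈ M.dispatchSet l) (pW : ℝ) (ω : Ω) :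
    (M.meritOrder pW y q).up ω ∈ Icc 0 (M.capF - q) ∧
    (M.meritOrder pW y q).down ω ∈ Icc 0 q ∧
    pW + (M.meritOrder pW y q).dW ω ∈ Icc 0 (M.W ω) ∧
    (M.meritOrder pW y q).shed ω ∈ Icc 0 l := by
  obtain ⟨⟨h1, h2, h3⟩, h4, h5⟩ := mem_dispatchSet.1 h
  have a1 := M.residual_mono ω (show y - M.capF ≤ y - q by linarith)
  have a2 := M.residual_mono ω (show y - q ≤ y by linarith)
  have a3 := M.residual_le_add (show y - M.capF ≤ y - q by linarith) ω
  have a4 := M.residual_le_add (show y - q ≤ y by linarith) ω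
  have a5 := M.residual_le h1 ω
  have a6 := M.sub_le_residual y ω
  have a7 := M.residual_nonneg (y - M.capF) ω
  dsimp only at a1 a2
  simp only [meritOrder, mem_Icc]
  refine ⟨⟨?_, ?_⟩, ⟨?_, ?_⟩, ⟨?_, ?_⟩, ?_, ?_⟩ <;> linarith

theorem isFeasible_meritOrderSchedule {l y q : ℝ} (h : (y, q) ∈ M.dispatchSet l) :
    M.IsFeasible l (M.meritOrderSchedule l y q) := by
  obtain ⟨⟨h1, h2, h3⟩, h4, h5⟩ := mem_dispatchSet.1 h
  have hb := M.meritOrder_bounds h (y - q)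
  refine
    { measurable_up := (M.measurable_residual _).sub (M.measurable_residual _)
      measurable_down := (measurable_const.add (M.measurable_residual _)).sub
        (M.measurable_residual _)
      measurable_dW := (measurable_const.sub (M.measurable_residual _)).sub measurable_const
      measurable_shed := M.measurable_residual _
      forward_balance := ?_
      pF_mem := ⟨h4, h5⟩
      pI_mem := ⟨sub_nonneg.2 h3, sub_le_comm.1 h2⟩
      balance := fun ω => ?_
      down_mem := fun ω => (hb ω).2.1
      up_mem := fun ω => (hb ω).1
      wind_mem := fun ω => (hb ω).2.2.1
      shed_mem := fun ω => (hb ω).2.2.2 }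
  · simp only [meritOrderSchedule]
    ring
  · simp only [meritOrderSchedule, meritOrder]
    ring

theorem expectedCost_meritOrder (l pW y q : ℝ) :
    M.expectedCost (l - y) q (M.meritOrder pW y q) = M.reducedCost l y q := by
  rw [expectedCost, reducedCost]
  have h := M.integral_residual_combination y q
  have h2 : ∀ ω, M.v * (M.meritOrder pW y q).shed ω + M.cUp * (M.meritOrder pW y q).up ω -
      M.cDown * (M.meritOrder pW y q).down ω =
      (M.v - M.cUp) * M.residual (y - M.capF) ω + M.cDown * M.residual y ω - M.cDown * q +
      (M.cUp - M.cDown) * M.residual (y - q) ω := fun ω => by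
    simp only [meritOrder]
    ring
  simp only [h2, h]
  ring

/-! ### Stochastic dispatch solutions -/

theorem continuous_reducedCost (l : ℝ) :
    Continuous fun p : ℝ × ℝ => M.reducedCost l p.1 p.2 := by
  have := M.continuous_H
  unfold reducedCost
  fun_prop

theorem exists_isStochasticSolution {l : ℝ} (hl : 0 ≤ l) : ∃ S, M.IsStochasticSolution l S := by
  have hne : (M.dispatchSet l).Nonempty :=
    ⟨(l, 0), mem_dispatchSet.2 ⟨⟨hl, by linarith [M.capI_pos], le_rfl⟩, le_rfl, M.capF_pos.le⟩⟩
  have hcpt : IsCompact (M.dispatchSet l) := isCompact_Icc.prod isCompact_Icc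
  obtain ⟨⟨y, q⟩, hmem, hmin⟩ :=
    hcpt.exists_isMinOn hne (M.continuous_reducedCost l).continuousOn
  refine ⟨M.meritOrderSchedule l y q, M.isFeasible_meritOrderSchedule hmem, fun S hS => ?_⟩
  calc M.expectedCost (l - y) q (M.meritOrder (y - q) y q) = M.reducedCost l y q :=
        M.expectedCost_meritOrder ..
    _ ≤ M.reducedCost l (l - S.pI) S.pF := hmin hS.mem_dispatchSet
    _ ≤ _ := hS.reducedCost_le

variable {M} in
theorem IsStochasticSolution.le_reducedCost {l y q : ℝ} {S : StochasticSchedule Ω}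
    (hS : M.IsStochasticSolution l S) (h : (y, q) ∈ M.dispatchSet l) :
    M.expectedCost S.pI S.pF S.r ≤ M.reducedCost l y q := by
  rw [← M.expectedCost_meritOrder l (y - q) y q]
  exact hS.2 _ (M.isFeasible_meritOrderSchedule h)

/-! ### Equilibria minimize the cost for their own flexible forward quantity -/

namespace IsEquilibrium

variable {M} {pWhat l : ℝ} {E : VirtualBiddingOutcome Ω}

theorem dV_eq (hE : M.IsEquilibrium pWhat l E) (ω : Ω) : E.dV ω = -E.pV := by
  linarith [hE.arb_feasible ω]

/-- Since the arbitrager can scale the virtual bid at will, the forward price is the expected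
balancing price. -/
theorem lamF_eq (hE : M.IsEquilibrium pWhat l E) : E.lamF = ∫ ω, E.lamB ω ∂M.P := by
  have key : ∀ q : ℝ, (q - E.pV) * (E.lamF - ∫ ω, E.lamB ω ∂M.P) ≤ 0 := fun q => by
    have h := hE.arb_optimal q (fun _ => -q) fun _ => by ring
    simp only [hE.dV_eq, integral_const_mul] at h
    linarith
  have h1 := key (E.pV + 1)
  have h2 := key (E.pV - 1)
  linarith

theorem balance_eq (hE : M.IsEquilibrium pWhat l E) (ω : Ω) :
    E.pF + E.r.up ω - E.r.down ω + (E.pW + E.r.dW ω) + E.r.shed ω = l - E.pI := by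
  linarith [hE.balance ω, hE.forward_balance, hE.dV_eq ω]

theorem cI_le_lamF (hE : M.IsEquilibrium pWhat l E) (h : E.pI ≠ 0) : M.cI ≤ E.lamF := by
  by_contra! hlt
  exact h ((BoxKKT.iff_sign.1 hE.forward_pI).2.2.1 (sub_pos.2 hlt))

theorem pI_eq_capI (hE : M.IsEquilibrium pWhat l E) (h : M.cI < E.lamF) : E.pI = M.capI :=
  (BoxKKT.iff_sign.1 hE.forward_pI).2.2.2 (sub_neg.2 h)

theorem cF_le_lamF (hE : M.IsEquilibrium pWhat l E) (h : E.pF ≠ 0) : M.cF ≤ E.lamF := by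
  by_contra! hlt
  exact h ((BoxKKT.iff_sign.1 hE.forward_pF).2.2.1 (sub_pos.2 hlt))

theorem pF_eq_capF (hE : M.IsEquilibrium pWhat l E) (h : M.cF < E.lamF) : E.pF = M.capF :=
  (BoxKKT.iff_sign.1 hE.forward_pF).2.2.2 (sub_neg.2 h)

/-- An equilibrium, with the virtual bid counted as stochastic forward production. -/
def toSchedule (E : VirtualBiddingOutcome Ω) : StochasticSchedule Ω where
  pI := E.pI
  pF := E.pF
  pW := E.pW + E.pV
  r := { E.r with dW := fun ω => E.r.dW ω - E.pV }

theorem isFeasible_toSchedule (hE : M.IsEquilibrium pWhat l E) :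
    M.IsFeasible l (toSchedule E) where
  measurable_up := hE.measurable_up
  measurable_down := hE.measurable_down
  measurable_dW := hE.measurable_dW.sub measurable_const
  measurable_shed := hE.measurable_shed
  forward_balance := by simpa [toSchedule, add_assoc] using hE.forward_balance
  pF_mem := ⟨hE.forward_pF.1, hE.forward_pF.2.1⟩
  pI_mem := ⟨hE.forward_pI.1, hE.forward_pI.2.1⟩
  balance ω := by
    simp only [toSchedule]
    linarith [hE.balance ω, hE.dV_eq ω]
  down_mem ω := ⟨(hE.bal_down ω).1, (hE.bal_down ω).2.1⟩
  up_mem ω := ⟨(hE.bal_up ω).1, (hE.bal_up ω).2.1⟩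
  wind_mem ω := by
    have h : E.pW + E.pV + (E.r.dW ω - E.pV) = E.pW + E.r.dW ω := by ring
    simp only [toSchedule, h]
    exact ⟨(hE.bal_wind ω).1, (hE.bal_wind ω).2.1⟩
  shed_mem ω := ⟨(hE.bal_shed ω).1, (hE.bal_shed ω).2.1⟩

theorem mem_dispatchSet (hE : M.IsEquilibrium pWhat l E) :
    (l - E.pI, E.pF) ∈ M.dispatchSet l :=
  hE.isFeasible_toSchedule.mem_dispatchSet

/-- Summing the variational inequalities of both markets: by `λᶠ = E λᵇ` the prices cancel for
every schedule with the same flexible forward quantity. -/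
theorem expectedCost_le (hE : M.IsEquilibrium pWhat l E) {S : StochasticSchedule Ω}
    (hS : M.IsFeasible l S) (hpF : S.pF = E.pF) :
    M.expectedCost E.pI E.pF E.r ≤ M.expectedCost S.pI S.pF S.r := by
  have hEi := hE.isFeasible_toSchedule.integrable_cost
  have hEi' : Integrable (fun ω => (M.v * E.r.shed ω + M.cUp * E.r.up ω - M.cDown * E.r.down ω) +
      E.lamB ω * (E.pI - S.pI)) M.P := hEi.add (hE.integrable_lamB.mul_const _)
  have h := integral_mono hEi' hS.integrable_cost fun ω => ?_
  · have h2 : ∫ ω, ((M.v * E.r.shed ω + M.cUp * E.r.up ω - M.cDown * E.r.down ω) +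
        E.lamB ω * (E.pI - S.pI)) ∂M.P =
        ∫ ω, (M.v * E.r.shed ω + M.cUp * E.r.up ω - M.cDown * E.r.down ω) ∂M.P +
        E.lamF * (E.pI - S.pI) := by
      rw [hE.lamF_eq, ← integral_mul_const]
      exact integral_add hEi (hE.integrable_lamB.mul_const _)
    have h3 := hE.forward_pI.mul_sub_nonneg hS.pI_mem
    rw [expectedCost, expectedCost, hpF]
    linarith
  · have b1 := hE.balance_eq ω
    have b2 := hS.balance_eq ω
    have k1 := (hE.bal_up ω).mul_sub_nonneg (hpF ▸ hS.up_mem ω)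
    have k2 := (hE.bal_down ω).mul_sub_nonneg (hpF ▸ hS.down_mem ω)
    have k3 := (hE.bal_wind ω).mul_sub_nonneg (hS.wind_mem ω)
    have k4 := (hE.bal_shed ω).mul_sub_nonneg (hS.shed_mem ω)
    have b3 : E.pI - S.pI = (S.r.up ω - E.r.up ω) - (S.r.down ω - E.r.down ω) +
        ((S.pW + S.r.dW ω) - (E.pW + E.r.dW ω)) + (S.r.shed ω - E.r.shed ω) := by linarith
    dsimp only
    rw [b3]
    linarith

theorem expectedCost_eq (hE : M.IsEquilibrium pWhat l E) :
    M.expectedCost E.pI E.pF E.r = M.reducedCost l (l - E.pI) E.pF := by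
  refine le_antisymm ?_ hE.isFeasible_toSchedule.reducedCost_le
  rw [← M.expectedCost_meritOrder l (l - E.pI - E.pF) (l - E.pI) E.pF]
  exact hE.expectedCost_le (M.isFeasible_meritOrderSchedule hE.mem_dispatchSet) rfl

theorem reducedCost_le (hE : M.IsEquilibrium pWhat l E) {y : ℝ}
    (hy : (y, E.pF) ∈ M.dispatchSet l) :
    M.reducedCost l (l - E.pI) E.pF ≤ M.reducedCost l y E.pF := by
  rw [← hE.expectedCost_eq, ← M.expectedCost_meritOrder l (y - E.pF) y E.pF]
  exact hE.expectedCost_le (M.isFeasible_meritOrderSchedule hy) rfl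

/-- An equilibrium is cost-efficient if its pair `(l - pI, pF)` minimizes the reduced cost. -/
theorem costEfficient_of_minimal (hE : M.IsEquilibrium pWhat l E) {S : StochasticSchedule Ω}
    (hS : M.IsStochasticSolution l S)
    (h : ∀ y q, (y, q) ∈ M.dispatchSet l →
      M.reducedCost l (l - E.pI) E.pF ≤ M.reducedCost l y q) :
    M.expectedCost E.pI E.pF E.r = M.expectedCost S.pI S.pF S.r := by
  rw [hE.expectedCost_eq]
  exact le_antisymm ((h _ _ hS.1.mem_dispatchSet).trans hS.1.reducedCost_le)
    (hS.le_reducedCost hE.mem_dispatchSet)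

end IsEquilibrium

/-! ### Balancing prices -/

/-- The largest balancing price in scenario `ω` that supports the merit-order redispatch at positive
load, demand `y` and flexible forward quantity `q`. -/
noncomputable def lamRight (y q : ℝ) (ω : Ω) : ℝ :=
  (M.v - M.cUp) * {ω | M.W ω ≤ y - M.capF}.indicator (fun _ => 1) ω +
    (M.cUp - M.cDown) * {ω | M.W ω ≤ y - q}.indicator (fun _ => 1) ω +
    M.cDown * {ω | M.W ω ≤ y}.indicator (fun _ => 1) ω

/-- The smallest nonnegative balancing price in scenario `ω` that supports the merit-order
redispatch at demand `y` and flexible forward quantity `q`. -/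
noncomputable def lamLeft (y q : ℝ) (ω : Ω) : ℝ :=
  (M.v - M.cUp) * {ω | M.W ω < y - M.capF}.indicator (fun _ => 1) ω +
    (M.cUp - M.cDown) * {ω | M.W ω < y - q}.indicator (fun _ => 1) ω +
    M.cDown * {ω | M.W ω < y}.indicator (fun _ => 1) ω

/-- The expectation of `lamRight`. -/
noncomputable def priceRight (y q : ℝ) : ℝ :=
  (M.v - M.cUp) * M.F (y - M.capF) + (M.cUp - M.cDown) * M.F (y - q) + M.cDown * M.F y

/-- The expectation of `lamLeft`. -/
noncomputable def priceLeft (y q : ℝ) : ℝ :=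
  (M.v - M.cUp) * M.Fleft (y - M.capF) + (M.cUp - M.cDown) * M.Fleft (y - q) + M.cDown * M.Fleft y

theorem priceRight_zero (y : ℝ) : M.priceRight y 0 = M.priceUp y := by
  rw [priceRight, priceUp, sub_zero]
  ring

theorem priceRight_capF (y : ℝ) : M.priceRight y M.capF = M.priceDown y := by
  rw [priceRight, priceDown]
  ring

theorem integrable_weighted_indicators {A B C : Set Ω} (hA : MeasurableSet A)
    (hB : MeasurableSet B) (hC : MeasurableSet C) (a b c : ℝ) :
    Integrable (fun ω => a * A.indicator (fun _ => (1 : ℝ)) ω + b * B.indicator (fun _ => 1) ω +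
      c * C.indicator (fun _ => 1) ω) M.P :=
  (((M.integrable_indicator_one hA).const_mul a).add
    ((M.integrable_indicator_one hB).const_mul b)).add
    ((M.integrable_indicator_one hC).const_mul c)

theorem integral_weighted_indicators {A B C : Set Ω} (hA : MeasurableSet A)
    (hB : MeasurableSet B) (hC : MeasurableSet C) (a b c : ℝ) :
    ∫ ω, (a * A.indicator (fun _ => (1 : ℝ)) ω + b * B.indicator (fun _ => 1) ω +
      c * C.indicator (fun _ => 1) ω) ∂M.P =
      a * M.P.real A + b * M.P.real B + c * M.P.real C := by
  have h1 := (M.integrable_indicator_one hA).const_mul a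
  have h2 := (M.integrable_indicator_one hB).const_mul b
  have h12 : Integrable (fun ω => a * A.indicator (fun _ => (1 : ℝ)) ω +
      b * B.indicator (fun _ => 1) ω) M.P := h1.add h2
  rw [integral_add h12 ((M.integrable_indicator_one hC).const_mul c), integral_add h1 h2,
    integral_const_mul, integral_const_mul, integral_const_mul, integral_indicator_const _ hA,
    integral_indicator_const _ hB, integral_indicator_const _ hC]
  simp

theorem integrable_lamRight (y q : ℝ) : Integrable (M.lamRight y q) M.P :=
  M.integrable_weighted_indicators (M.measurableSet_W_le _) (M.measurableSet_W_le _)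
    (M.measurableSet_W_le _) _ _ _

theorem integrable_lamLeft (y q : ℝ) : Integrable (M.lamLeft y q) M.P :=
  M.integrable_weighted_indicators (M.measurableSet_W_lt _) (M.measurableSet_W_lt _)
    (M.measurableSet_W_lt _) _ _ _

theorem integral_lamRight (y q : ℝ) : ∫ ω, M.lamRight y q ω ∂M.P = M.priceRight y q := by
  simp only [priceRight, F_eq_real]
  exact M.integral_weighted_indicators (M.measurableSet_W_le _) (M.measurableSet_W_le _)
    (M.measurableSet_W_le _) _ _ _

theorem integral_lamLeft (y q : ℝ) : ∫ ω, M.lamLeft y q ω ∂M.P = M.priceLeft y q :=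
  M.integral_weighted_indicators (M.measurableSet_W_lt _) (M.measurableSet_W_lt _)
    (M.measurableSet_W_lt _) _ _ _

theorem le_lamRight_iff {y q : ℝ} (hq : q ∈ Icc 0 M.capF) {ω : Ω} {p : ℝ} :
    p ≤ M.lamRight y q ω ↔ p ≤ M.v ∧ (y - M.capF < M.W ω → p ≤ M.cUp) ∧
      (y - q < M.W ω → p ≤ M.cDown) ∧ (y < M.W ω → p ≤ 0) := by
  have h1 := M.cUp_lt_v
  have h2 := M.cDown_le_cUp
  have h3 := M.cDown_nonneg
  obtain ⟨hq0, hq1⟩ := hq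
  simp only [lamRight, indicator_apply, mem_ofPred_eq]
  constructor
  · intro h
    refine ⟨?_, fun _ => ?_, fun _ => ?_, fun _ => ?_⟩ <;> split_ifs at h <;> linarith
  · rintro ⟨g1, g2, g3, g4⟩
    split_ifs with i1 i2 i3 i3 i2 i3 i3
    all_goals first
      | linarith
      | linarith [g2 (not_le.1 i1)]
      | linarith [g3 (not_le.1 i2)]
      | linarith [g4 (not_le.1 i3)]

theorem lamLeft_le_iff {y q : ℝ} (hq : q ∈ Icc 0 M.capF) {ω : Ω} {p : ℝ} :
    M.lamLeft y q ω ≤ p ↔ 0 ≤ p ∧ (M.W ω < y → M.cDown ≤ p) ∧ (M.W ω < y - q → M.cUp ≤ p) ∧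
      (M.W ω < y - M.capF → M.v ≤ p) := by
  have h1 := M.cUp_lt_v
  have h2 := M.cDown_le_cUp
  have h3 := M.cDown_nonneg
  obtain ⟨hq0, hq1⟩ := hq
  simp only [lamLeft, indicator_apply, mem_ofPred_eq]
  constructor
  · intro h
    refine ⟨?_, fun _ => ?_, fun _ => ?_, fun _ => ?_⟩ <;> split_ifs at h <;> linarith
  · rintro ⟨g1, g2, g3, g4⟩
    split_ifs with i1 i2 i3 i3 i2 i3 i3
    all_goals first
      | linarith
      | linarith [g4 i1]
      | linarith [g3 i2]
      | linarith [g2 i3]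

namespace IsEquilibrium

variable {M} {pWhat l : ℝ} {E : VirtualBiddingOutcome Ω}

theorem lamB_le_lamRight (hE : M.IsEquilibrium pWhat l E) (ω : Ω) :
    E.lamB ω ≤ M.lamRight (l - E.pI) E.pF ω := by
  have h1 := M.cUp_lt_v
  have h2 := M.cDown_le_cUp
  have h3 := M.cDown_nonneg
  have hI := hE.forward_pI.1
  have hF := hE.forward_pF
  have hb := hE.balance_eq ω
  have hW := M.W_nonneg ω
  obtain ⟨u1, u2, -, u3⟩ := BoxKKT.iff_sign.1 (hE.bal_up ω)
  obtain ⟨d1, d2, d3, -⟩ := BoxKKT.iff_sign.1 (hE.bal_down ω)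
  obtain ⟨w1, w2, -, w3⟩ := BoxKKT.iff_sign.1 (hE.bal_wind ω)
  obtain ⟨s1, s2, -, s3⟩ := BoxKKT.iff_sign.1 (hE.bal_shed ω)
  rw [M.le_lamRight_iff ⟨hF.1, hF.2.1⟩]
  refine ⟨?_, fun h => ?_, fun h => ?_, fun h => ?_⟩ <;> by_contra! hlt
  · linarith [u3 (by linarith), d3 (by linarith), w3 (by linarith), s3 (by linarith), M.capF_pos]
  · linarith [u3 (by linarith), d3 (by linarith), w3 (by linarith)]
  · linarith [d3 (by linarith), w3 (by linarith)]
  · linarith [w3 (by linarith)]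

theorem lamLeft_le_lamB (hE : M.IsEquilibrium pWhat l E) (hy : 0 < l - E.pI) (ω : Ω) :
    M.lamLeft (l - E.pI) E.pF ω ≤ E.lamB ω := by
  have h1 := M.cUp_lt_v
  have h2 := M.cDown_le_cUp
  have h3 := M.cDown_nonneg
  have hF := hE.forward_pF
  have hb := hE.balance_eq ω
  obtain ⟨u1, u2, u3, -⟩ := BoxKKT.iff_sign.1 (hE.bal_up ω)
  obtain ⟨d1, d2, -, d3⟩ := BoxKKT.iff_sign.1 (hE.bal_down ω)
  obtain ⟨w1, w2, w3, -⟩ := BoxKKT.iff_sign.1 (hE.bal_wind ω)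
  obtain ⟨s1, s2, s3, -⟩ := BoxKKT.iff_sign.1 (hE.bal_shed ω)
  rw [M.lamLeft_le_iff ⟨hF.1, hF.2.1⟩]
  refine ⟨?_, fun h => ?_, fun h => ?_, fun h => ?_⟩ <;> by_contra! hlt
  · linarith [u3 (by linarith), d3 (by linarith), w3 (by linarith), s3 (by linarith)]
  · linarith [u3 (by linarith), d3 (by linarith), s3 (by linarith)]
  · linarith [u3 (by linarith), s3 (by linarith)]
  · linarith [s3 (by linarith)]

theorem lamF_le_priceRight (hE : M.IsEquilibrium pWhat l E) :
    E.lamF ≤ M.priceRight (l - E.pI) E.pF := by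
  rw [hE.lamF_eq, ← integral_lamRight]
  exact integral_mono hE.integrable_lamB (M.integrable_lamRight _ _) hE.lamB_le_lamRight

theorem priceLeft_le_lamF (hE : M.IsEquilibrium pWhat l E) (hy : 0 < l - E.pI) :
    M.priceLeft (l - E.pI) E.pF ≤ E.lamF := by
  rw [hE.lamF_eq, ← integral_lamLeft]
  exact integral_mono (M.integrable_lamLeft _ _) hE.integrable_lamB (hE.lamLeft_le_lamB hy)

end IsEquilibrium

theorem Fleft_nonneg (t : ℝ) : 0 ≤ M.Fleft t := measureReal_nonneg

theorem priceLeft_nonneg (y q : ℝ) : 0 ≤ M.priceLeft y q := by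
  have h1 := mul_nonneg (sub_nonneg.2 M.cUp_lt_v.le) (M.Fleft_nonneg (y - M.capF))
  have h2 := mul_nonneg (sub_nonneg.2 M.cDown_le_cUp) (M.Fleft_nonneg (y - q))
  have h3 := mul_nonneg M.cDown_nonneg (M.Fleft_nonneg y)
  rw [priceLeft]
  linarith

theorem priceLeft_le_priceRight (y q : ℝ) : M.priceLeft y q ≤ M.priceRight y q := by
  have h1 := mul_le_mul_of_nonneg_left (M.Fleft_le_F (y - M.capF)) (sub_nonneg.2 M.cUp_lt_v.le)
  have h2 := mul_le_mul_of_nonneg_left (M.Fleft_le_F (y - q)) (sub_nonneg.2 M.cDown_le_cUp)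
  have h3 := mul_le_mul_of_nonneg_left (M.Fleft_le_F y) M.cDown_nonneg
  rw [priceLeft, priceRight]
  linarith

theorem priceRight_mono (q : ℝ) : Monotone fun y => M.priceRight y q := by
  intro y y' h
  have h1 := mul_le_mul_of_nonneg_left (M.F_mono (show y - M.capF ≤ y' - M.capF by linarith))
    (sub_nonneg.2 M.cUp_lt_v.le)
  have h2 := mul_le_mul_of_nonneg_left (M.F_mono (show y - q ≤ y' - q by linarith))
    (sub_nonneg.2 M.cDown_le_cUp)
  have h3 := mul_le_mul_of_nonneg_left (M.F_mono h) M.cDown_nonneg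
  simp only [priceRight]
  linarith

theorem priceRight_anti (y : ℝ) : Antitone fun q => M.priceRight y q := by
  intro q q' h
  have h2 := mul_le_mul_of_nonneg_left (M.F_mono (show y - q' ≤ y - q by linarith))
    (sub_nonneg.2 M.cDown_le_cUp)
  simp only [priceRight]
  linarith

theorem priceRight_of_neg {y q : ℝ} (hy : y < 0) (hq : 0 ≤ q) : M.priceRight y q = 0 := by
  rw [priceRight, M.F_of_neg hy, M.F_of_neg (by linarith [M.capF_pos]), M.F_of_neg (by linarith)]
  ring

theorem priceRight_of_large {y q : ℝ} (h1 : M.capW ≤ y - M.capF) (hq : q ∈ Icc 0 M.capF) :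
    M.priceRight y q = M.v := by
  rw [priceRight, M.F_of_capW_le h1, M.F_of_capW_le (by linarith [hq.2]),
    M.F_of_capW_le (by linarith [hq.1, hq.2])]
  ring

theorem priceRight_rightContinuous (q y : ℝ) :
    ContinuousWithinAt (fun y => M.priceRight y q) (Ioi y) y := by
  have h : ∀ k, Tendsto (fun y' => M.F (y' - k)) (𝓝[>] y) (𝓝 (M.F (y - k))) := fun k =>
    (M.F_rightContinuous (y - k)).tendsto.comp (tendsto_sub_nhdsGT y k)
  exact (((h _).const_mul _).add ((h _).const_mul _)).add
    ((M.F_rightContinuous y).tendsto.const_mul _)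

theorem tendsto_priceLeft (q y : ℝ) :
    Tendsto (fun y => M.priceRight y q) (𝓝[<] y) (𝓝 (M.priceLeft y q)) := by
  have h : ∀ k, Tendsto (fun y' => M.F (y' - k)) (𝓝[<] y) (𝓝 (M.Fleft (y - k))) := fun k =>
    (M.tendsto_Fleft (y - k)).comp (tendsto_sub_nhdsLT y k)
  exact (((h _).const_mul _).add ((h _).const_mul _)).add ((M.tendsto_Fleft y).const_mul _)

theorem priceLeft_le_of_forall_lt {y q c : ℝ} (h : ∀ z < y, M.priceRight z q ≤ c) :
    M.priceLeft y q ≤ c :=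
  le_of_tendsto (M.tendsto_priceLeft q y) (eventually_nhdsWithin_of_forall h)

/-! ### The characteristic constants -/

theorem bddBelow_nonneg_and (p : ℝ → Prop) : BddBelow {x : ℝ | 0 ≤ x ∧ p x} :=
  ⟨0, fun _ hx => And.left hx⟩

theorem cF_lt_v : M.cF < M.v := M.cF_le_cUp.trans_lt M.cUp_lt_v

theorem l2_nonneg : 0 ≤ M.l2 := Real.sInf_nonneg fun _ hx => And.left hx

theorem cI_le_priceUp_l2 (hc : M.cI < M.cF) : M.cI ≤ M.priceUp M.l2 := by
  rw [← priceRight_zero]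
  refine le_apply_csInf_of_rightContinuous (M.priceRight_mono 0) (M.priceRight_rightContinuous 0)
    (S := {l : ℝ | 0 ≤ l ∧ M.cI ≤ M.priceUp l})
    ⟨M.capW + M.capF, by linarith [M.capW_pos, M.capF_pos], ?_⟩ fun x hx => ?_
  · rw [← priceRight_zero, M.priceRight_of_large (by linarith) ⟨le_rfl, M.capF_pos.le⟩]
    exact (hc.trans M.cF_lt_v).le
  · simpa only [priceRight_zero] using And.right hx

theorem priceUp_lt_of_lt_l2 {y : ℝ} (hy : y < M.l2) : M.priceUp y < M.cI := by
  by_contra! h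
  rcases lt_or_ge y 0 with h0 | h0
  · rw [← priceRight_zero, M.priceRight_of_neg h0 le_rfl] at h
    linarith [M.cI_pos]
  · exact notMem_of_lt_csInf hy (bddBelow_nonneg_and _) ⟨h0, h⟩

theorem priceUp_lt_of_lt_l5 {l : ℝ} (hl : l < M.l5) : M.priceUp (l - M.capI) < M.cF := by
  by_contra! h
  rcases lt_or_ge (l - M.capI) 0 with h0 | h0
  · rw [← priceRight_zero, M.priceRight_of_neg h0 le_rfl] at h
    linarith [M.cF_pos]
  · exact notMem_of_lt_csInf hl (bddBelow_nonneg_and _) ⟨by linarith [M.capI_pos], h⟩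

theorem cF_le_priceUp_of_l5_lt {l : ℝ} (hl : M.l5 < l) : M.cF ≤ M.priceUp (l - M.capI) := by
  obtain ⟨z, ⟨-, hz⟩, hzl⟩ := exists_lt_of_csInf_lt (s := {l : ℝ | 0 ≤ l ∧
    M.cF ≤ M.priceUp (l - M.capI)}) ⟨M.capI + M.capW + M.capF,
      by linarith [M.capW_pos, M.capF_pos, M.capI_pos], by
        rw [← priceRight_zero, M.priceRight_of_large (by linarith) ⟨le_rfl, M.capF_pos.le⟩]
        exact M.cF_lt_v.le⟩ hl
  refine hz.trans ?_
  rw [← priceRight_zero, ← priceRight_zero]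
  exact M.priceRight_mono 0 (by linarith)

theorem priceDown_lt_of_lt_l6 {l : ℝ} (hl : l < M.l6) : M.priceDown (l - M.capI) < M.cF := by
  by_contra! h
  rcases lt_or_ge (l - M.capI) 0 with h0 | h0
  · rw [← priceRight_capF, M.priceRight_of_neg h0 M.capF_pos.le] at h
    linarith [M.cF_pos]
  · exact notMem_of_lt_csInf hl (bddBelow_nonneg_and _) ⟨by linarith [M.capI_pos], h⟩

theorem cF_le_priceDown_of_l6_le {l : ℝ} (hl : M.l6 ≤ l) : M.cF ≤ M.priceDown (l - M.capI) := by
  have hmono : Monotone fun l => M.priceRight (l - M.capI) M.capF := fun a b h =>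
    M.priceRight_mono M.capF (by linarith)
  have h := le_apply_csInf_of_rightContinuous hmono
    (fun x => (M.priceRight_rightContinuous M.capF (x - M.capI)).tendsto.comp
      (tendsto_sub_nhdsGT x M.capI))
    (S := {l : ℝ | 0 ≤ l ∧ M.cF ≤ M.priceDown (l - M.capI)}) (c := M.cF)
    ⟨M.capI + M.capW + M.capF, by linarith [M.capW_pos, M.capF_pos, M.capI_pos], by
        rw [← priceRight_capF, M.priceRight_of_large (by linarith) ⟨M.capF_pos.le, le_rfl⟩]
        exact M.cF_lt_v.le⟩
    fun x hx => by simpa only [priceRight_capF] using And.right hx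
  rw [← priceRight_capF]
  exact h.trans (hmono hl)

/-- The flexible unit is scheduled only from load `l5` on. -/
theorem IsEquilibrium.l5_le {M : PowerSystem Ω} {pWhat l : ℝ} {E : VirtualBiddingOutcome Ω}
    (hE : M.IsEquilibrium pWhat l E) (hc : M.cI < M.cF) (h : E.pF ≠ 0) : M.l5 ≤ l := by
  have h1 := hE.cF_le_lamF h
  have hI := hE.pI_eq_capI (hc.trans_le h1)
  have h2 := hE.lamF_le_priceRight
  have h3 := M.priceRight_anti (l - E.pI) hE.forward_pF.1
  rw [hI] at h2 h3
  simp only [priceRight_zero] at h3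
  exact le_of_not_gt fun hlt => absurd (M.priceUp_lt_of_lt_l5 hlt) (by linarith)

/-! ### Existence of equilibria -/

/-- A forward price between `priceLeft` and `priceRight` is the expectation of balancing prices that
support the merit-order redispatch, hence part of an equilibrium if it clears the forward
market. -/
theorem exists_isEquilibrium_of_price {pWhat l y q p : ℝ} (hpWhat : 0 ≤ pWhat)
    (h : (y, q) ∈ M.dispatchSet l) (hp : p ∈ Icc (M.priceLeft y q) (M.priceRight y q))
    (hpF : BoxKKT (M.cF - p) q 0 M.capF) (hpI : BoxKKT (M.cI - p) (l - y) 0 M.capI) :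
    ∃ E, M.IsEquilibrium pWhat l E ∧ E.pF = q := by
  have hp0 : 0 ≤ p := (M.priceLeft_nonneg y q).trans hp.1
  obtain ⟨⟨hy, h2, h3⟩, hq⟩ := mem_dispatchSet.1 h
  -- the weights that express `p` by the extreme expected prices also combine the extreme
  -- scenario prices
  rw [← segment_eq_Icc (M.priceLeft_le_priceRight y q)] at hp
  obtain ⟨a, b, ha, hb, hab, rfl⟩ := hp
  have hi : Integrable (fun ω => a * M.lamLeft y q ω + b * M.lamRight y q ω) M.P :=
    ((M.integrable_lamLeft y q).const_mul a).add ((M.integrable_lamRight y q).const_mul b)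
  have hint : ∫ ω, (a * M.lamLeft y q ω + b * M.lamRight y q ω) ∂M.P =
      a • M.priceLeft y q + b • M.priceRight y q := by
    rw [integral_add ((M.integrable_lamLeft y q).const_mul a)
      ((M.integrable_lamRight y q).const_mul b), integral_const_mul, integral_const_mul,
      integral_lamLeft, integral_lamRight, smul_eq_mul, smul_eq_mul]
  set lam : Ω → ℝ := fun ω => a * M.lamLeft y q ω + b * M.lamRight y q ω with hlam
  set p : ℝ := a • M.priceLeft y q + b • M.priceRight y q with hpdef
  have hLR : ∀ ω, M.lamLeft y q ω ≤ M.lamRight y q ω := fun ω => by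
    rw [M.lamLeft_le_iff hq]
    have h1 := M.cUp_lt_v
    have h2 := M.cDown_le_cUp
    have h3 := M.cDown_nonneg
    obtain ⟨hq0, hq1⟩ := hq
    simp only [lamRight, indicator_apply, mem_ofPred_eq]
    refine ⟨?_, fun _ => ?_, fun _ => ?_, fun _ => ?_⟩ <;> split_ifs <;> linarith
  have hlow : ∀ ω, M.lamLeft y q ω ≤ lam ω := fun ω => by
    have := mul_le_mul_of_nonneg_left (hLR ω) hb
    have h1 : M.lamLeft y q ω = a * M.lamLeft y q ω + b * M.lamLeft y q ω := by
      rw [← add_mul, hab, one_mul]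
    simp only [hlam]
    linarith
  have hupp : ∀ ω, lam ω ≤ M.lamRight y q ω := fun ω => by
    have := mul_le_mul_of_nonneg_left (hLR ω) ha
    have h1 : M.lamRight y q ω = a * M.lamRight y q ω + b * M.lamRight y q ω := by
      rw [← add_mul, hab, one_mul]
    simp only [hlam]
    linarith
  have hbds := M.meritOrder_bounds h pWhat
  have hfeas := M.isFeasible_meritOrderSchedule h
  refine ⟨{ pI := l - y, pF := q, pW := pWhat, pV := y - q - pWhat,
            dV := fun _ => -(y - q - pWhat), r := M.meritOrder pWhat y q, lamF := p, lamB := lam },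
    { measurable_up := hfeas.measurable_up
      measurable_down := hfeas.measurable_down
      measurable_dW := (measurable_const.sub (M.measurable_residual _)).sub measurable_const
      measurable_shed := hfeas.measurable_shed
      integrable_lamB := hi
      forward_balance := by ring
      forward_pW := BoxKKT.iff_sign.2 ⟨hpWhat, le_rfl, fun h => by linarith, fun _ => rfl⟩
      forward_pF := hpF
      forward_pI := hpI
      balance := fun ω => by
        simp only [meritOrder]
        ring
      bal_up := fun ω => ?_
      bal_down := fun ω => ?_
      bal_wind := fun ω => ?_
      bal_shed := fun ω => ?_
      arb_feasible := fun ω => by ring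
      arb_optimal := fun q' d hd => ?_ }, rfl⟩
  · refine BoxKKT.iff_sign.2 ⟨(hbds ω).1.1, (hbds ω).1.2, fun hs => ?_, fun hs => ?_⟩
    · have : y - q ≤ M.W ω := by
        by_contra! hlt
        linarith [((M.lamLeft_le_iff hq).1 (hlow ω)).2.2.1 hlt]
      simp only [meritOrder, residual]
      rw [max_eq_right (by linarith), max_eq_right (by linarith [hq.2]), sub_zero]
    · have : M.W ω ≤ y - M.capF := by
        by_contra! hlt
        linarith [((M.le_lamRight_iff hq).1 (hupp ω)).2.1 hlt]
      simp only [meritOrder, residual]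
      rw [max_eq_left (by linarith [hq.2]), max_eq_left (by linarith)]
      ring
  · refine BoxKKT.iff_sign.2 ⟨(hbds ω).2.1.1, (hbds ω).2.1.2, fun hs => ?_, fun hs => ?_⟩
    · have : M.W ω ≤ y - q := by
        by_contra! hlt
        linarith [((M.le_lamRight_iff hq).1 (hupp ω)).2.2.1 hlt]
      simp only [meritOrder, residual]
      rw [max_eq_left (by linarith), max_eq_left (by linarith [hq.1])]
      ring
    · have : y ≤ M.W ω := by
        by_contra! hlt
        linarith [((M.lamLeft_le_iff hq).1 (hlow ω)).2.1 hlt]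
      simp only [meritOrder, residual]
      rw [max_eq_right (by linarith [hq.1]), max_eq_right (by linarith)]
      ring
  · refine BoxKKT.iff_sign.2 ⟨(hbds ω).2.2.1.1, (hbds ω).2.2.1.2, fun hs => ?_, fun hs => ?_⟩
    · linarith [((M.lamLeft_le_iff hq).1 (hlow ω)).1]
    · have : M.W ω ≤ y := by
        by_contra! hlt
        linarith [((M.le_lamRight_iff hq).1 (hupp ω)).2.2.2 hlt]
      simp only [meritOrder, residual]
      rw [max_eq_left (by linarith)]
      ring
  · refine BoxKKT.iff_sign.2 ⟨(hbds ω).2.2.2.1, (hbds ω).2.2.2.2, fun hs => ?_, fun hs => ?_⟩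
    · have : y - M.capF ≤ M.W ω := by
        by_contra! hlt
        linarith [((M.lamLeft_le_iff hq).1 (hlow ω)).2.2.2 hlt]
      simp only [meritOrder, residual]
      rw [max_eq_right (by linarith)]
    · linarith [((M.le_lamRight_iff hq).1 (hupp ω)).1]
  · have hd' : d = fun _ => -q' := funext fun ω => by linarith [hd ω]
    simp only [hd', integral_const_mul, hint]
    linarith

theorem exists_isEquilibrium_pF_zero (hc : M.cI < M.cF) {pWhat l : ℝ} (hpWhat : 0 ≤ pWhat)
    (hl : 0 ≤ l) (hl5 : l ≤ M.l5) : ∃ E, M.IsEquilibrium pWhat l E ∧ E.pF = 0 := by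
  have hq : (0 : ℝ) ≤ 0 ∧ 0 ≤ M.capF := ⟨le_rfl, M.capF_pos.le⟩
  have hkkt : ∀ {p}, p ≤ M.cF → BoxKKT (M.cF - p) 0 0 M.capF := fun hp =>
    BoxKKT.iff_sign.2 ⟨hq.1, hq.2, fun _ => rfl, fun h => absurd h (by linarith)⟩
  have hleft : M.priceLeft M.l2 0 ≤ M.cI := M.priceLeft_le_of_forall_lt fun z hz => by
    rw [priceRight_zero]
    exact (M.priceUp_lt_of_lt_l2 hz).le
  have hright : M.cI ≤ M.priceRight M.l2 0 := by
    rw [priceRight_zero]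
    exact M.cI_le_priceUp_l2 hc
  have hcapI := M.capI_pos
  rcases le_total l M.l2 with h2 | h2
  · -- all demand is left to the balancing market
    have hp : M.priceLeft l 0 ≤ M.cI := M.priceLeft_le_of_forall_lt fun z hz => by
      rw [priceRight_zero]
      exact (M.priceUp_lt_of_lt_l2 (hz.trans_le h2)).le
    refine M.exists_isEquilibrium_of_price hpWhat
      (mem_dispatchSet.2 ⟨⟨hl, by linarith, le_rfl⟩, hq⟩)
      ⟨le_rfl, M.priceLeft_le_priceRight l 0⟩ (hkkt (hp.trans hc.le)) ?_
    rw [sub_self]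
    exact BoxKKT.iff_sign.2 ⟨le_rfl, hcapI.le, fun _ => rfl, fun h => absurd h (by linarith)⟩
  rcases le_total l (M.l2 + M.capI) with h3 | h3
  · -- the inflexible unit is marginal
    refine M.exists_isEquilibrium_of_price hpWhat
      (mem_dispatchSet.2 ⟨⟨M.l2_nonneg, by linarith, h2⟩, hq⟩) ⟨hleft, hright⟩ (hkkt hc.le) ?_
    exact BoxKKT.iff_sign.2 ⟨by linarith, by linarith, fun h => absurd h (by linarith),
      fun h => absurd h (by linarith)⟩
  · -- the inflexible unit is exhausted
    have hp : M.priceLeft (l - M.capI) 0 ≤ M.cF := M.priceLeft_le_of_forall_lt fun z hz => by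
      rw [priceRight_zero]
      have := M.priceUp_lt_of_lt_l5 (l := z + M.capI) (by linarith)
      rw [add_sub_cancel_right] at this
      exact this.le
    have hp2 : M.cI ≤ M.priceRight (l - M.capI) 0 :=
      hright.trans (M.priceRight_mono 0 (by linarith))
    refine M.exists_isEquilibrium_of_price hpWhat (y := l - M.capI)
      (p := max M.cI (M.priceLeft (l - M.capI) 0))
      (mem_dispatchSet.2 ⟨⟨by linarith [M.l2_nonneg], le_rfl, by linarith⟩, hq⟩)
      ⟨le_max_right _ _, max_le hp2 (M.priceLeft_le_priceRight _ _)⟩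
      (hkkt (max_le hc.le hp)) ?_
    rw [sub_sub_cancel]
    exact BoxKKT.iff_sign.2 ⟨hcapI.le, le_rfl,
      fun h => absurd h (by linarith [le_max_left M.cI (M.priceLeft (l - M.capI) 0)]), fun _ => rfl⟩

theorem exists_isEquilibrium_pF_capF (hc : M.cI < M.cF) {pWhat l : ℝ} (hpWhat : 0 ≤ pWhat)
    (hl6 : M.l6 ≤ l) : ∃ E, M.IsEquilibrium pWhat l E ∧ E.pF = M.capF := by
  have hp := M.cF_le_priceDown_of_l6_le hl6
  rw [← priceRight_capF] at hp
  have hy : 0 ≤ l - M.capI := by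
    by_contra! h
    rw [M.priceRight_of_neg h M.capF_pos.le] at hp
    linarith [M.cF_pos]
  refine M.exists_isEquilibrium_of_price hpWhat (y := l - M.capI)
    (mem_dispatchSet.2 ⟨⟨hy, le_rfl, by linarith [M.capI_pos]⟩, M.capF_pos.le, le_rfl⟩)
    ⟨M.priceLeft_le_priceRight _ _, le_rfl⟩ ?_ ?_
  · exact BoxKKT.iff_sign.2 ⟨M.capF_pos.le, le_rfl, fun h => absurd h (by linarith), fun _ => rfl⟩
  · rw [sub_sub_cancel]
    exact BoxKKT.iff_sign.2 ⟨M.capI_pos.le, le_rfl, fun h => absurd h (by linarith), fun _ => rfl⟩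

/-- Between `l5` and `l6` the flexible unit is marginal: its forward quantity `q` is chosen such
that `y - q` is the smallest level at which the right price reaches `cF`. -/
theorem exists_isEquilibrium_between (hc : M.cI < M.cF) {pWhat l : ℝ} (hpWhat : 0 ≤ pWhat)
    (hl5 : M.l5 < l) (hl6 : l < M.l6) : ∃ E, M.IsEquilibrium pWhat l E := by
  have h5 := M.cF_le_priceUp_of_l5_lt hl5
  have h6 := M.priceDown_lt_of_lt_l6 hl6
  have hy : 0 ≤ l - M.capI := by
    by_contra! h
    rw [← priceRight_zero, M.priceRight_of_neg h le_rfl] at h5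
    linarith [M.cF_pos]
  rw [← priceRight_zero] at h5
  rw [← priceRight_capF] at h6
  generalize hyy : l - M.capI = y at h5 h6 hy
  set G : ℝ → ℝ := fun r => (M.v - M.cUp) * M.F (y - M.capF) + (M.cUp - M.cDown) * M.F r +
    M.cDown * M.F y with hG
  have hGmono : Monotone G := fun a b hab => by
    have := mul_le_mul_of_nonneg_left (M.F_mono hab) (sub_nonneg.2 M.cDown_le_cUp)
    simp only [hG]
    linarith
  have hGr : ∀ x, ContinuousWithinAt G (Ioi x) x := fun x =>
    ((M.F_rightContinuous x).tendsto.const_mul _ |>.const_add _).add_const _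
  have hGprice : ∀ q, M.priceRight y q = G (y - q) := fun q => rfl
  set S : Set ℝ := {r | y - M.capF ≤ r ∧ M.cF ≤ G r} with hS
  have hyS : y ∈ S := ⟨by linarith [M.capF_pos], by simpa [hGprice] using h5⟩
  have hbdd : BddBelow S := ⟨y - M.capF, fun _ hx => And.left hx⟩
  have hr1 : M.cF ≤ G (sInf S) :=
    le_apply_csInf_of_rightContinuous hGmono hGr ⟨y, hyS⟩ fun _ hx => And.right hx
  have hr2 : sInf S ≤ y := csInf_le hbdd hyS
  have hr3 : y - M.capF < sInf S := by
    by_contra! h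
    have := hGmono h
    rw [← hGprice] at this
    linarith
  have hleft : M.priceLeft y (y - sInf S) ≤ M.cF := by
    have ht : Tendsto G (𝓝[<] (sInf S)) (𝓝 ((M.v - M.cUp) * M.F (y - M.capF) +
        (M.cUp - M.cDown) * M.Fleft (sInf S) + M.cDown * M.F y)) :=
      ((M.tendsto_Fleft _).const_mul _ |>.const_add _).add_const _
    have h1 := le_of_tendsto ht (b := M.cF) (by
      filter_upwards [Ioo_mem_nhdsLT hr3] with r hr
      by_contra! hlt
      exact notMem_of_lt_csInf hr.2 hbdd ⟨hr.1.le, hlt.le⟩)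
    have h2 := mul_le_mul_of_nonneg_left (M.Fleft_le_F (y - M.capF)) (sub_nonneg.2 M.cUp_lt_v.le)
    have h3 := mul_le_mul_of_nonneg_left (M.Fleft_le_F y) M.cDown_nonneg
    rw [priceLeft, sub_sub_cancel]
    linarith
  obtain ⟨E, hE, -⟩ := M.exists_isEquilibrium_of_price hpWhat (l := l) (y := y) (q := y - sInf S)
    (p := M.cF) (mem_dispatchSet.2 ⟨⟨hy, hyy.le, by linarith [M.capI_pos]⟩, by linarith,
      by linarith⟩) ⟨hleft, by rwa [hGprice, sub_sub_cancel]⟩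
    (BoxKKT.iff_sign.2 ⟨by linarith, by linarith, fun h => absurd h (by linarith),
      fun h => absurd h (by linarith)⟩)
    (BoxKKT.iff_sign.2 ⟨by linarith [M.capI_pos], by linarith, fun h => absurd h (by linarith),
      fun _ => by linarith⟩)
  exact ⟨E, hE⟩

theorem exists_isEquilibrium (hc : M.cI < M.cF) {pWhat l : ℝ} (hpWhat : 0 ≤ pWhat)
    (hl : 0 ≤ l) : ∃ E, M.IsEquilibrium pWhat l E := by
  rcases le_or_gt l M.l5 with h5 | h5
  · exact (M.exists_isEquilibrium_pF_zero hc hpWhat hl h5).imp fun _ h => h.1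
  rcases le_or_gt M.l6 l with h6 | h6
  · exact (M.exists_isEquilibrium_pF_capF hc hpWhat h6).imp fun _ h => h.1
  · exact M.exists_isEquilibrium_between hc hpWhat h5 h6

/-! ### First-order conditions for the reduced problem -/

/-- The first-order lower bound on the reduced cost given by subgradients `a`, `b`, `c` of `H` at
`y - capF`, `y` and `y - q`. -/
theorem reducedCost_add_le {a b c y q : ℝ}
    (ha : ∀ t, M.H (y - M.capF) + a * (t - (y - M.capF)) ≤ M.H t)
    (hb : ∀ t, M.H y + b * (t - y) ≤ M.H t)
    (hc : ∀ t, M.H (y - q) + c * (t - (y - q)) ≤ M.H t) (l y' q' : ℝ) :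
    M.reducedCost l y q +
      ((M.v - M.cUp) * a + (M.cUp - M.cDown) * c + M.cDown * b - M.cI) * (y' - y) +
      (M.cF - M.cDown - (M.cUp - M.cDown) * c) * (q' - q) ≤ M.reducedCost l y' q' := by
  have h1 := mul_le_mul_of_nonneg_left (ha (y' - M.capF)) (sub_nonneg.2 M.cUp_lt_v.le)
  have h2 := mul_le_mul_of_nonneg_left (hb y') M.cDown_nonneg
  have h3 := mul_le_mul_of_nonneg_left (hc (y' - q')) (sub_nonneg.2 M.cDown_le_cUp)
  rw [reducedCost, reducedCost]
  linarith

theorem reducedCost_add_priceRight_le (l y q y' q' : ℝ) :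
    M.reducedCost l y q + (M.priceRight y q - M.cI) * (y' - y) +
      (M.cF - M.cDown - (M.cUp - M.cDown) * M.F (y - q)) * (q' - q) ≤ M.reducedCost l y' q' :=
  M.reducedCost_add_le (M.H_add_F_mul_le _) (M.H_add_F_mul_le _) (M.H_add_F_mul_le _) l y' q'

/-- Scheduling no flexible production is optimal for the demand `y` as long as the probability
`F y` of a nonnegative residual demand does not exceed the critical ratio. -/
theorem reducedCost_zero_le {y q : ℝ} (hq : 0 ≤ q)
    (h : (M.cUp - M.cDown) * M.F y ≤ M.cF - M.cDown) (l : ℝ) :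
    M.reducedCost l y 0 ≤ M.reducedCost l y q := by
  have h1 := M.reducedCost_add_priceRight_le l y 0 y q
  rw [sub_self, mul_zero, sub_zero, sub_zero] at h1
  linarith [mul_nonneg (sub_nonneg.2 h) hq]

theorem Finv_of_nonpos {α : ℝ} (hα : α ≤ 0) : M.Finv α = 0 :=
  le_antisymm (csInf_le (s := {x : ℝ | 0 ≤ x ∧ α ≤ M.F x}) (bddBelow_nonneg_and _)
    ⟨le_rfl, hα.trans (M.F_nonneg 0)⟩) (M.Finv_nonneg α)

theorem critical_ratio_le_one : (M.cF - M.cDown) / (M.cUp - M.cDown) ≤ 1 :=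
  div_le_one_of_le₀ (by linarith [M.cF_le_cUp]) (sub_nonneg.2 M.cDown_le_cUp)

/-- If `l1 > 0`, the critical ratio is positive and, by continuity, attained by `F` at `l1`. -/
theorem critical_ratio_of_l1_pos (hF : ContinuousOn M.F (Ioi 0)) (h : 0 < M.l1) :
    0 < (M.cF - M.cDown) / (M.cUp - M.cDown) ∧
      M.F M.l1 = (M.cF - M.cDown) / (M.cUp - M.cDown) := by
  have hα : 0 < (M.cF - M.cDown) / (M.cUp - M.cDown) := by
    by_contra! h0
    exact h.ne' (M.Finv_of_nonpos h0)
  exact ⟨hα, M.F_Finv hα M.critical_ratio_le_one (hF.continuousAt (Ioi_mem_nhds h))⟩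

namespace IsEquilibrium

variable {M} {pWhat l : ℝ} {E : VirtualBiddingOutcome Ω} {S : StochasticSchedule Ω}

/-! ### Sufficient conditions for cost-efficiency -/

/-- If the load can be met with demand at most `l1` and the price at `l1` covers `cI`, an
equilibrium without flexible forward production is efficient: demands below `l1` require none,
and demands above `l1` are no cheaper than `l1` itself. -/
theorem costEfficient_of_le_capI_add_l1 (hE : M.IsEquilibrium pWhat l E)
    (hS : M.IsStochasticSolution l S) (hα : 0 < (M.cF - M.cDown) / (M.cUp - M.cDown))
    (hprice : M.cI ≤ (M.v - M.cUp) * M.F (M.l1 - M.capF) +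
      M.cUp * ((M.cF - M.cDown) / (M.cUp - M.cDown)))
    (hl : l ≤ M.capI + M.l1) (hpF : E.pF = 0) :
    M.expectedCost E.pI E.pF E.r = M.expectedCost S.pI S.pF S.r := by
  have hne : M.cUp - M.cDown ≠ 0 := fun h => by simp [h] at hα
  have hα1 := M.critical_ratio_le_one
  have hmul : (M.cUp - M.cDown) * ((M.cF - M.cDown) / (M.cUp - M.cDown)) = M.cF - M.cDown :=
    mul_div_cancel₀ _ hne
  have hl1 : M.l1 = M.Finv ((M.cF - M.cDown) / (M.cUp - M.cDown)) := rfl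
  generalize (M.cF - M.cDown) / (M.cUp - M.cDown) = α at hα hprice hα1 hmul hl1
  refine hE.costEfficient_of_minimal hS fun y q hyq => ?_
  obtain ⟨⟨h1, h2, h3⟩, h4, h5⟩ := PowerSystem.mem_dispatchSet.1 hyq
  have hmin : ∀ {z}, 0 ≤ z → l - M.capI ≤ z → z ≤ l →
      M.reducedCost l (l - E.pI) E.pF ≤ M.reducedCost l z 0 := fun {z} a b c => by
    have hz : (z, E.pF) ∈ M.dispatchSet l :=
      PowerSystem.mem_dispatchSet.2 ⟨⟨a, b, c⟩, hpF.ge, hpF.le.trans M.capF_pos.le⟩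
    simpa only [hpF] using hE.reducedCost_le hz
  rcases lt_or_ge y M.l1 with hy | hy
  · refine (hmin h1 h2 h3).trans (M.reducedCost_zero_le h4 ?_ l)
    rw [← hmul]
    exact mul_le_mul_of_nonneg_left (M.F_lt_of_lt_Finv hα (hl1 ▸ hy)).le
      (sub_nonneg.2 M.cDown_le_cUp)
  · have hsub : ∀ t, M.H M.l1 + α * (t - M.l1) ≤ M.H t := by
      rw [hl1]
      exact M.H_Finv_add_mul_le hα hα1
    have h6 := M.reducedCost_add_le (M.H_add_F_mul_le (M.l1 - M.capF)) hsub
      (q := 0) (c := α) (by simpa only [sub_zero] using hsub) l y q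
    have h7 := hmin (hl1 ▸ M.Finv_nonneg α) (by linarith) (hy.trans h3)
    rw [hmul, sub_self, zero_mul, add_zero] at h6
    have h8 : 0 ≤ ((M.v - M.cUp) * M.F (M.l1 - M.capF) + (M.cF - M.cDown) + M.cDown * α - M.cI) *
        (y - M.l1) := mul_nonneg (by linarith) (sub_nonneg.2 hy)
    linarith

theorem costEfficient_of_cUp_eq_cF (hE : M.IsEquilibrium pWhat l E)
    (hS : M.IsStochasticSolution l S) (hU : M.cUp = M.cF) (hpF : E.pF = 0) :
    M.expectedCost E.pI E.pF E.r = M.expectedCost S.pI S.pF S.r := by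
  refine hE.costEfficient_of_minimal hS fun y q hyq => ?_
  obtain ⟨h, h4, h5⟩ := PowerSystem.mem_dispatchSet.1 hyq
  have h6 := hE.reducedCost_le
    (PowerSystem.mem_dispatchSet.2 ⟨h, hpF.ge, hpF.le.trans M.capF_pos.le⟩)
  rw [hpF] at h6 ⊢
  refine h6.trans (M.reducedCost_zero_le h4 ?_ l)
  rw [hU]
  exact mul_le_of_le_one_right (sub_nonneg.2 M.cDown_le_cF) (M.F_le_one y)

/-- If the flexible forward quantity satisfies the newsvendor condition and the inflexible unit is
rightly exhausted, the equilibrium is efficient. -/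
theorem costEfficient_of_newsvendor (hE : M.IsEquilibrium pWhat l E)
    (hS : M.IsStochasticSolution l S) (hI : E.pI = M.capI)
    (hprice : M.cI ≤ M.priceRight (l - E.pI) E.pF)
    (hnews : (M.cUp - M.cDown) * M.F (l - E.pI - E.pF) = M.cF - M.cDown) :
    M.expectedCost E.pI E.pF E.r = M.expectedCost S.pI S.pF S.r := by
  refine hE.costEfficient_of_minimal hS fun y q hyq => ?_
  obtain ⟨⟨-, h2, -⟩, -⟩ := PowerSystem.mem_dispatchSet.1 hyq
  have h := M.reducedCost_add_priceRight_le l (l - E.pI) E.pF y q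
  rw [hnews, sub_self, zero_mul, add_zero] at h
  have h3 : l - E.pI ≤ y := by rwa [hI]
  linarith [mul_nonneg (sub_nonneg.2 hprice) (sub_nonneg.2 h3)]

theorem costEfficient_of_capW_add_le (hE : M.IsEquilibrium pWhat l E)
    (hS : M.IsStochasticSolution l S) (hc : M.cI < M.cF) (hU : M.cUp = M.cF)
    (hl : M.capW + M.capI + M.capF ≤ l) :
    M.expectedCost E.pI E.pF E.r = M.expectedCost S.pI S.pF S.r := by
  by_cases hpF : E.pF = 0
  · exact hE.costEfficient_of_cUp_eq_cF hS hU hpF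
  have hI := hE.pI_eq_capI (hc.trans_le (hE.cF_le_lamF hpF))
  refine hE.costEfficient_of_newsvendor hS hI ?_ ?_
  · rw [M.priceRight_of_large (by linarith) ⟨hE.forward_pF.1, hE.forward_pF.2.1⟩]
    exact (hc.trans M.cF_lt_v).le
  · rw [M.F_of_capW_le (by linarith [hE.forward_pF.2.1]), hU, mul_one]

theorem costEfficient_of_le_capI_add_capW (hE : M.IsEquilibrium pWhat l E)
    (hS : M.IsStochasticSolution l S) (hc : M.cI < M.cF) (hU : M.cUp = M.cF)
    (hcap : M.capW < M.capF) (hl : l ≤ M.capI + M.capW) :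
    M.expectedCost E.pI E.pF E.r = M.expectedCost S.pI S.pF S.r := by
  by_cases hpF : E.pF = 0
  · exact hE.costEfficient_of_cUp_eq_cF hS hU hpF
  have h1 := hE.cF_le_lamF hpF
  have hI := hE.pI_eq_capI (hc.trans_le h1)
  have h2 := hE.lamF_le_priceRight
  refine hE.costEfficient_of_newsvendor hS hI (hc.le.trans (h1.trans h2)) ?_
  rw [priceRight, M.F_of_neg (t := l - E.pI - M.capF) (by linarith), hU] at h2
  rw [hU]
  -- a price of at least `cF` forces `F (y - pF) = 1` unless its weight vanishes
  refine le_antisymm (mul_le_of_le_one_right (sub_nonneg.2 M.cDown_le_cF) (M.F_le_one _)) ?_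
  linarith [mul_le_of_le_one_right M.cDown_nonneg (M.F_le_one (l - E.pI))]

/-- Without regulation premia the cost does not depend on the flexible forward quantity. -/
theorem costEfficient_of_no_premium (hE : M.IsEquilibrium pWhat l E)
    (hS : M.IsStochasticSolution l S) (hU : M.cF = M.cUp) (hD : M.cF = M.cDown) :
    M.expectedCost E.pI E.pF E.r = M.expectedCost S.pI S.pF S.r := by
  refine hE.costEfficient_of_minimal hS fun y q hyq => ?_
  obtain ⟨h, h4⟩ := PowerSystem.mem_dispatchSet.1 hyq
  refine (hE.reducedCost_le (PowerSystem.mem_dispatchSet.2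
    ⟨h, hE.forward_pF.1, hE.forward_pF.2.1⟩)).trans_eq ?_
  simp [reducedCost, ← hU, ← hD]

/-- For loads up to `capI + l1` the probability that upward regulation is needed stays below the
critical ratio, and there is no shedding, so that scheduling flexible production would bring the
forward price below `cF`. -/
theorem pF_eq_zero_of_le_capI_add_l1 (hE : M.IsEquilibrium pWhat l E) (hc : M.cI < M.cF)
    (hDU : M.cDown < M.cUp) (hα : 0 < (M.cF - M.cDown) / (M.cUp - M.cDown))
    (hcap : M.capW < M.capF) (hl : l ≤ M.capI + M.l1) : E.pF = 0 := by
  by_contra hpF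
  have h1 := hE.cF_le_lamF hpF
  have hI := hE.pI_eq_capI (hc.trans_le h1)
  have h2 := hE.lamF_le_priceRight
  have hl1 := M.Finv_le_capW M.critical_ratio_le_one
  change M.l1 ≤ M.capW at hl1
  have hpos : 0 < E.pF := lt_of_le_of_ne hE.forward_pF.1 (Ne.symm hpF)
  have h3 : M.F (l - E.pI - E.pF) < (M.cF - M.cDown) / (M.cUp - M.cDown) :=
    M.F_lt_of_lt_Finv hα (show l - E.pI - E.pF < M.l1 by linarith)
  rw [lt_div_iff₀ (sub_pos.2 hDU)] at h3
  rw [priceRight, M.F_of_neg (t := l - E.pI - M.capF) (by linarith)] at h2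
  linarith [mul_le_of_le_one_right M.cDown_nonneg (M.F_le_one (l - E.pI))]

end IsEquilibrium

/-! ### Free downward regulation -/

theorem F_eq_zero_of_nonpos (hF0 : ∀ x : ℝ, 0 ≤ x → (M.F x = 0 ↔ x = 0)) {t : ℝ}
    (ht : t ≤ 0) : M.F t = 0 :=
  le_antisymm ((M.F_mono ht).trans_eq ((hF0 0 le_rfl).2 rfl)) (M.F_nonneg t)

theorem F_pos_of_pos (hF0 : ∀ x : ℝ, 0 ≤ x → (M.F x = 0 ↔ x = 0)) {t : ℝ} (ht : 0 < t) :
    0 < M.F t :=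
  lt_of_le_of_ne (M.F_nonneg t) fun h => ht.ne' ((hF0 t ht.le).1 h.symm)

theorem priceLeft_eq_priceRight (hF : ContinuousOn M.F (Ioi 0))
    (hF0 : ∀ x : ℝ, 0 ≤ x → (M.F x = 0 ↔ x = 0)) (y q : ℝ) :
    M.priceLeft y q = M.priceRight y q := by
  have h : ∀ t, M.Fleft t = M.F t := fun t => by
    rcases le_or_gt t 0 with ht | ht
    · have h0 := M.F_eq_zero_of_nonpos hF0 ht
      exact le_antisymm (M.Fleft_le_F t) (h0.trans_le (M.Fleft_nonneg t))
    · exact M.Fleft_eq_F (hF.continuousAt (Ioi_mem_nhds ht))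
  simp only [priceLeft, priceRight, h]

theorem priceRight_eq_zero_of_nonpos (hF0 : ∀ x : ℝ, 0 ≤ x → (M.F x = 0 ↔ x = 0))
    {y q : ℝ} (hy : y ≤ 0) (hq : 0 ≤ q) : M.priceRight y q = 0 := by
  rw [priceRight, M.F_eq_zero_of_nonpos hF0 hy,
    M.F_eq_zero_of_nonpos hF0 (by linarith [M.capF_pos] : y - M.capF ≤ 0),
    M.F_eq_zero_of_nonpos hF0 (by linarith : y - q ≤ 0)]
  ring

namespace IsEquilibrium

variable {M} {pWhat l : ℝ} {E : VirtualBiddingOutcome Ω} {S : StochasticSchedule Ω}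

/-- With free downward regulation it is optimal to schedule all flexible capacity, so that an
equilibrium is efficient if it bears the same upward regulation as full scheduling. -/
theorem costEfficient_of_H_eq (hE : M.IsEquilibrium pWhat l E)
    (hS : M.IsStochasticSolution l S) (hc : M.cI < M.cF) (hD : M.cF = M.cDown) (hl6 : M.l6 ≤ l)
    (hI : E.pI = M.capI) (hH : M.H (l - E.pI - E.pF) = M.H (l - E.pI - M.capF)) :
    M.expectedCost E.pI E.pF E.r = M.expectedCost S.pI S.pF S.r := by
  refine hE.costEfficient_of_minimal hS fun y q hyq => ?_
  obtain ⟨⟨-, h2, -⟩, -, h5⟩ := PowerSystem.mem_dispatchSet.1 hyq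
  have h := M.reducedCost_add_priceRight_le l (l - E.pI) M.capF y q
  have hp := M.cF_le_priceDown_of_l6_le hl6
  rw [← priceRight_capF, ← hI] at hp
  have heq : M.reducedCost l (l - E.pI) E.pF = M.reducedCost l (l - E.pI) M.capF := by
    simp only [reducedCost, hH, hD, sub_self, zero_mul]
  have h3 : l - E.pI ≤ y := by rwa [hI]
  have h6 := mul_nonneg (sub_nonneg.2 (hc.le.trans hp)) (sub_nonneg.2 h3)
  have h7 := mul_nonneg (mul_nonneg (sub_nonneg.2 M.cDown_le_cUp)
    (M.F_nonneg (l - E.pI - M.capF))) (sub_nonneg.2 h5)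
  rw [heq]
  rw [hD] at h
  linarith

/-- From load `l6` on the forward price is at least `cF`, whatever the flexible forward quantity. -/
theorem pI_lamF_of_l6_le (hE : M.IsEquilibrium pWhat l E) (hc : M.cI < M.cF)
    (hF : ContinuousOn M.F (Ioi 0)) (hF0 : ∀ x : ℝ, 0 ≤ x → (M.F x = 0 ↔ x = 0))
    (hl6 : M.l6 ≤ l) :
    E.pI = M.capI ∧ M.priceDown (l - M.capI) ≤ E.lamF ∧
      E.lamF = M.priceRight (l - M.capI) E.pF := by
  have hp := M.cF_le_priceDown_of_l6_le hl6
  have hy : 0 < l - M.capI := by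
    by_contra! h
    rw [← priceRight_capF, M.priceRight_eq_zero_of_nonpos hF0 h M.capF_pos.le] at hp
    linarith [M.cF_pos]
  have hyE : l - M.capI ≤ l - E.pI := by linarith [hE.forward_pI.2.1]
  have h1 := hE.priceLeft_le_lamF (hy.trans_le hyE)
  rw [M.priceLeft_eq_priceRight hF hF0] at h1
  have h2 : M.priceDown (l - M.capI) ≤ E.lamF := by
    rw [← priceRight_capF]
    exact ((M.priceRight_mono M.capF hyE).trans
      (M.priceRight_anti (l - E.pI) hE.forward_pF.2.1)).trans h1
  have hI := hE.pI_eq_capI (hc.trans_le (hp.trans h2))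
  have h3 := hE.lamF_le_priceRight
  rw [hI] at h1 h3
  exact ⟨hI, h2, le_antisymm h3 h1⟩

theorem costEfficient_of_l6_le (hE : M.IsEquilibrium pWhat l E)
    (hS : M.IsStochasticSolution l S) (hc : M.cI < M.cF) (hD : M.cF = M.cDown)
    (hF : ContinuousOn M.F (Ioi 0)) (hF0 : ∀ x : ℝ, 0 ≤ x → (M.F x = 0 ↔ x = 0))
    (hl6 : M.l6 ≤ l) (hsel : M.priceDown (l - M.capI) = M.cF → E.pF = M.capF) :
    M.expectedCost E.pI E.pF E.r = M.expectedCost S.pI S.pF S.r := by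
  obtain ⟨hI, h2, -⟩ := hE.pI_lamF_of_l6_le hc hF hF0 hl6
  have hpF : E.pF = M.capF := by
    rcases (M.cF_le_priceDown_of_l6_le hl6).eq_or_lt with h | h
    · exact hsel h.symm
    · exact hE.pF_eq_capF (h.trans_le h2)
  exact hE.costEfficient_of_H_eq hS hc hD hl6 hI (by rw [hpF])

/-- If the stochastic production almost surely stays below some level less than `capF`, an
equilibrium that does not schedule all flexible capacity still covers the whole demand by flexible
forward production, since any exposure to upward regulation would lift the price above `cF`. -/
theorem costEfficient_of_l6_le_of_F_eq_one (hE : M.IsEquilibrium pWhat l E)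
    (hS : M.IsStochasticSolution l S) (hc : M.cI < M.cF) (hD : M.cF = M.cDown)
    (hU : M.cF < M.cUp) (hF : ContinuousOn M.F (Ioi 0))
    (hF0 : ∀ x : ℝ, 0 ≤ x → (M.F x = 0 ↔ x = 0)) (hone : ∃ y < M.capF, M.F y = 1)
    (hl6 : M.l6 ≤ l) : M.expectedCost E.pI E.pF E.r = M.expectedCost S.pI S.pF S.r := by
  obtain ⟨hI, h2, h3⟩ := hE.pI_lamF_of_l6_le hc hF hF0 hl6
  have hp := M.cF_le_priceDown_of_l6_le hl6
  by_cases hpF : E.pF = M.capF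
  · exact hE.costEfficient_of_H_eq hS hc hD hl6 hI (by rw [hpF])
  have hlam : E.lamF ≤ M.cF := le_of_not_gt fun h => hpF (hE.pF_eq_capF h)
  have hcover : l - M.capI ≤ E.pF := by
    by_contra! hlt
    have hF1 := M.F_pos_of_pos hF0 (sub_pos.2 hlt)
    rcases le_or_gt (l - M.capI) M.capF with hle | hgt
    · have hz := M.F_eq_zero_of_nonpos hF0 (sub_nonpos.2 hle)
      rw [priceDown, hz, ← hD] at hp
      rw [priceRight, hz, ← hD] at h3
      linarith [mul_pos (sub_pos.2 hU) hF1]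
    · obtain ⟨z, hz, hz1⟩ := hone
      have hF2 : M.F (l - M.capI) = 1 :=
        le_antisymm (M.F_le_one _) (hz1.ge.trans (M.F_mono (hz.trans hgt).le))
      have hF3 := M.F_pos_of_pos hF0 (sub_pos.2 hgt)
      rw [priceDown, hF2, ← hD] at h2
      linarith [mul_pos (sub_pos.2 M.cF_lt_v) hF3]
  have hcapF := hE.forward_pF.2.1
  refine hE.costEfficient_of_H_eq hS hc hD hl6 hI ?_
  rw [hI, M.H_of_nonpos (by linarith), M.H_of_nonpos (by linarith)]

/-- Below load `l6` the forward price is too low for the flexible forward quantity that avoids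
costly upward regulation, so scheduling all flexible capacity is strictly cheaper. -/
theorem expectedCost_lt_of_lt_l6 (hE : M.IsEquilibrium pWhat l E)
    (hS : M.IsStochasticSolution l S) (hD : M.cF = M.cDown) (hc : M.cI < M.cF)
    (hU : M.cF < M.cUp) (hF0 : ∀ x : ℝ, 0 ≤ x → (M.F x = 0 ↔ x = 0)) (hl : 0 < l)
    (hl6 : l < M.l6) : M.expectedCost S.pI S.pF S.r < M.expectedCost E.pI E.pF E.r := by
  have hle := hE.lamF_le_priceRight
  have key : E.pF < M.capF ∧ 0 < l - E.pI - E.pF := by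
    by_cases hpF : E.pF = 0
    · refine ⟨hpF ▸ M.capF_pos, ?_⟩
      by_contra! hy
      have h1 := hE.cI_le_lamF (by linarith)
      rw [M.priceRight_eq_zero_of_nonpos hF0 (by linarith) hE.forward_pF.1] at hle
      linarith [M.cI_pos]
    · have h1 := hE.cF_le_lamF hpF
      have hI := hE.pI_eq_capI (hc.trans_le h1)
      have h2 := M.priceDown_lt_of_lt_l6 hl6
      rw [← priceRight_capF, ← hI] at h2
      refine ⟨lt_of_le_of_ne hE.forward_pF.2.1 fun h => ?_, ?_⟩
      · rw [h] at hle
        linarith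
      · by_contra! hy
        have hcapF := hE.forward_pF.2.1
        have hz : M.F (l - E.pI - M.capF) = 0 := M.F_eq_zero_of_nonpos hF0 (by linarith)
        rw [priceRight, hz, M.F_eq_zero_of_nonpos hF0 hy] at hle
        rw [priceRight, hz] at h2
        linarith
  have hH := M.H_lt (fun x hx => M.F_pos_of_pos hF0 hx)
    (show l - E.pI - M.capF < l - E.pI - E.pF by linarith [key.1]) key.2
  have hmem := PowerSystem.mem_dispatchSet.1 hE.mem_dispatchSet
  refine (hS.le_reducedCost (PowerSystem.mem_dispatchSet.2
    ⟨hmem.1, M.capF_pos.le, le_rfl⟩)).trans_lt ?_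
  rw [hE.expectedCost_eq, reducedCost, reducedCost, ← hD]
  linarith [mul_lt_mul_of_pos_left hH (sub_pos.2 hU)]

end IsEquilibrium

theorem l6_le_threshold : M.l6 ≤ M.threshold := by
  unfold threshold
  split_ifs <;> exact le_max_left _ _

/-- If the stochastic production exceeds every level below `capF` with positive probability, then
`l6` dominates the other terms of the threshold. -/
theorem threshold_le_l6 (hc : M.cI < M.cF) (hD : M.cF = M.cDown)
    (hlt : ∀ y < M.capF, M.F y < 1) : M.threshold ≤ M.l6 := by
  have hp := M.cF_le_priceDown_of_l6_le le_rfl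
  have h1 : M.capF + M.capI ≤ M.l6 := by
    by_contra! h
    have hy : M.l6 - M.capI < M.capF := by linarith
    rw [priceDown, M.F_of_neg (sub_neg.2 hy), ← hD] at hp
    linarith [mul_lt_mul_of_pos_left (hlt _ hy) M.cF_pos]
  have hl1 : M.l1 = 0 := M.Finv_of_nonpos (by simp [hD])
  have h2 : M.l4 ≤ M.l6 - M.capI :=
    csInf_le (s := {l : ℝ | M.l1 + M.capF ≤ l ∧ M.cI ≤ M.priceDown l})
      ⟨M.l1 + M.capF, fun _ hx => And.left hx⟩ ⟨by linarith, hc.le.trans hp⟩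
  unfold threshold
  split_ifs
  · exact max_le le_rfl (by linarith)
  · exact max_le le_rfl h1

end PowerSystem

theorem mainTheorem4 {Ω : Type*} [MeasurableSpace Ω] (M : PowerSystem Ω)
    (hF : ContinuousOn M.F (Set.Ioi 0)) (hc : M.cI < M.cF)
    (pWhat : ℝ) (hpWhat : 0 ≤ pWhat) :
    -- existence of the solutions that are compared, and of those selected at boundary loads
    (∀ l : ℝ, 0 ≤ l →
      (∃ S, M.IsStochasticSolution l S) ∧
      (∃ E, M.IsEquilibrium pWhat l E) ∧
      (l ≤ M.l5 → ∃ E, M.IsEquilibrium pWhat l E ∧ E.pF = 0) ∧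
      (M.l6 ≤ l → ∃ E, M.IsEquilibrium pWhat l E ∧ E.pF = M.capF)) ∧
    -- comparison of the expected costs
    (∀ l : ℝ, 0 ≤ l →
      ∀ S, M.IsStochasticSolution l S → ∀ E, M.IsEquilibrium pWhat l E →
        -- case 1
        (M.l2 ≤ M.l1 → 0 < M.l1 → l ≤ min (M.capI + M.l1) M.l5 → (l = M.l5 → E.pF = 0) →
          M.expectedCost E.pI E.pF E.r = M.expectedCost S.pI S.pF S.r) ∧
        -- case 2
        (M.cDown < M.cUp → M.cI / M.cUp ≤ (M.cF - M.cDown) / (M.cUp - M.cDown) →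
          M.capW < M.capF → l ≤ M.capI + M.l1 →
          M.expectedCost E.pI E.pF E.r = M.expectedCost S.pI S.pF S.r) ∧
        -- case 3
        (M.cUp = M.cF → l ∉ Set.Ioo M.l5 (M.capW + M.capI + M.capF) → (l = M.l5 → E.pF = 0) →
          M.expectedCost E.pI E.pF E.r = M.expectedCost S.pI S.pF S.r) ∧
        -- case 4
        (M.cUp = M.cF → M.capW < M.capF →
          (l ≤ M.capI + M.capW ∨ M.capW + M.capI + M.capF ≤ l) →
          M.expectedCost E.pI E.pF E.r = M.expectedCost S.pI S.pF S.r) ∧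
        -- case 5
        (M.cF = M.cUp → M.cF = M.cDown →
          M.expectedCost E.pI E.pF E.r = M.expectedCost S.pI S.pF S.r) ∧
        -- free downward regulation, costly upward regulation, `F⁻¹(0) = 0`
        (M.cF = M.cDown → M.cF < M.cUp → (∀ x : ℝ, 0 ≤ x → (M.F x = 0 ↔ x = 0)) →
          (M.threshold ≤ l → (M.priceDown (l - M.capI) = M.cF → E.pF = M.capF) →
            M.expectedCost E.pI E.pF E.r = M.expectedCost S.pI S.pF S.r) ∧
          ((∀ y < M.capF, M.F y < 1) → 0 < l → l < M.threshold →
            M.expectedCost S.pI S.pF S.r < M.expectedCost E.pI E.pF E.r) ∧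
          ((∃ y < M.capF, M.F y = 1) →
            (0 < l → l < M.l6 →
              M.expectedCost S.pI S.pF S.r < M.expectedCost E.pI E.pF E.r) ∧
            (M.l6 ≤ l →
              M.expectedCost E.pI E.pF E.r = M.expectedCost S.pI S.pF S.r)))) := by
  refine ⟨fun l hl => ⟨M.exists_isStochasticSolution hl, M.exists_isEquilibrium hc hpWhat hl,
    M.exists_isEquilibrium_pF_zero hc hpWhat hl, M.exists_isEquilibrium_pF_capF hc hpWhat⟩,
    fun l _ S hS E hE => ⟨?_, ?_, ?_, ?_, ?_, ?_⟩⟩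
  · intro h21 h1 hl h5
    have hpF : E.pF = 0 := by
      by_contra hne
      exact hne (h5 (le_antisymm (hl.trans (min_le_right _ _)) (hE.l5_le hc hne)))
    obtain ⟨hα, hFα⟩ := M.critical_ratio_of_l1_pos hF h1
    refine hE.costEfficient_of_le_capI_add_l1 hS hα ?_ (hl.trans (min_le_left _ _)) hpF
    have hm := M.priceRight_mono 0 h21
    simp only [PowerSystem.priceRight_zero] at hm
    rw [← hFα]
    exact (M.cI_le_priceUp_l2 hc).trans hm
  · intro hDU hratio hcap hl
    have hα := (div_pos M.cI_pos M.cUp_pos).trans_le hratio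
    refine hE.costEfficient_of_le_capI_add_l1 hS hα ?_ hl
      (hE.pF_eq_zero_of_le_capI_add_l1 hc hDU hα hcap hl)
    rw [div_le_iff₀' M.cUp_pos] at hratio
    linarith [mul_nonneg (sub_nonneg.2 M.cUp_lt_v.le) (M.F_nonneg (M.l1 - M.capF))]
  · intro hU hl h5
    rcases lt_trichotomy l M.l5 with h | h | h
    · refine hE.costEfficient_of_cUp_eq_cF hS hU ?_
      by_contra hne
      exact absurd (hE.l5_le hc hne) h.not_ge
    · exact hE.costEfficient_of_cUp_eq_cF hS hU (h5 h)
    · exact hE.costEfficient_of_capW_add_le hS hc hU (le_of_not_gt fun h' => hl ⟨h, h'⟩)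
  · rintro hU hcap (hl | hl)
    · exact hE.costEfficient_of_le_capI_add_capW hS hc hU hcap hl
    · exact hE.costEfficient_of_capW_add_le hS hc hU hl
  · exact hE.costEfficient_of_no_premium hS
  · intro hD hU hF0
    exact ⟨fun hl hsel => hE.costEfficient_of_l6_le hS hc hD hF hF0
        (M.l6_le_threshold.trans hl) hsel,
      fun hlt hl0 hl => hE.expectedCost_lt_of_lt_l6 hS hD hc hU hF0 hl0
        (hl.trans_le (M.threshold_le_l6 hc hD hlt)),
      fun hone => ⟨fun hl0 hl => hE.expectedCost_lt_of_lt_l6 hS hD hc hU hF0 hl0 hl,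
        hE.costEfficient_of_l6_le_of_F_eq_one hS hc hD hU hF hF0 hone⟩⟩
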